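/- **Conventions.** Let $\mathbb D=\{z\in\mathbb C:|z|<1\}$ and $\mathbb B^n=\{x\in\mathbb R^n:|x|<1\}$. A conformal surface is a (Hausdorff, not necessarily orientable) surface $M$ with an atlas of charts in $\mathbb R^2=\mathbb C$ whose transition maps are conformal, possibly orientation reversing, diffeomorphisms between plane domains. A connected conformal surface $M$ is hyperbolic if there is a conformal covering map $h:\mathbb D\to M$ (which is then a universal covering). Its Poincaré metric $\mathcal P_M$ is the metric for which such an $h$ is a local isometry, where $\mathcal P_{\mathbb D}(z,\eta)=\frac{|\eta|}{1-|z|^2}$; that is, $\mathcal P_M(h(z),dh_z\eta)=\mathcal P_{\mathbb D}(z,\eta)$ for all $z\in\mathbb D$ and $\eta\in\mathbb R^2$. The Cayley–Klein metric on $\mathbb B^n$ is $$\mathcal{CK}(x,v)=\sqrt{\frac{|v|^2}{1-|x|^2}+\frac{(x\cdot v)^2}{(1-|x|^2)^2}},\qquad x\in\mathbb B^n,\ v\in\mathbb R^n.$$ Let $d_M$ and $d_{\mathcal{CK}}$ be the distances on $M$ and $\mathbb B^n$ induced by $\mathcal P_M$ and $\mathcal{CK}$, i.e. the infima of the lengths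 of $\mathscr C^1$ paths joining two given points. A map $f:M\to\mathbb R^n$ is harmonic if it is harmonic in every conformal chart, and conformal if in every conformal chart $x+iy$ it satisfies $|f_x|=|f_y|$ and $f_x\cdot f_y=0$ at every point (so the differential may vanish at some points). An affine disc in $\mathbb B^n$ is a nonempty intersection of $\mathbb B^n$ with an affine $2$-plane. **Theorem 2.6.** Let $M$ be a connected hyperbolic conformal surface with its Poincaré metric $\mathcal P_M$, let $n\ge 3$, and let $f:M\to\mathbb B^n$ be a conformal harmonic map. Then $$\mathcal{CK}\bigl(f(p),df_p(\xi)\bigr)\le \mathcal P_M(p,\xi)\qquad\text{for all } p\in M,\ \xi\in T_pM,$$ and $f$ is distance-decreasing: $$d_{\mathcal{CK}}(f(p),f(q))\le d_M(p,q)\qquad\text{for all } p,q\in M.$$ If equality holds in the first inequality for some $p\in M$ and some $0\ne\xi\in T_pM$, or if $d_{\mathcal{CK}}(f(p),f(q))=d_M(p,q)$ for some pair of distinct points $p,q\in M$, then $M$ is conformally diffeomorphic to $\mathbb D$ and $f$ is a conformal diffeomorphism of $M$ onto an affine disc in $\mathbb B^n$. -/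

import Mathlib

open Set Metric MeasureTheory
open scoped Manifold ContDiff ENNReal

noncomputable section

/-! ### Conformal surfaces

A conformal surface is a Hausdorff space `M` with an atlas of charts in `ℂ = ℝ²` whose transition
maps are conformal diffeomorphisms (not necessarily orientation preserving) between plane domains:
`[TopologicalSpace M] [T2Space M] [ChartedSpace ℂ M] [IsManifold 𝓘(ℝ, ℂ) ∞ M]
[HasGroupoid M (conformalGroupoid (X := ℂ))]`. -/

section ConformalSurface

variable {M : Type*} [TopologicalSpace M] [ChartedSpace ℂ M]

/-- `h`, restricted to the open unit disc `𝔻`, is a smooth conformal covering map of `𝔻` onto the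
conformal surface `M`. As `𝔻` is simply connected, it is a universal conformal covering.
Only the values of `h` on `𝔻` matter. -/
structure IsConformalDiscCovering (h : ℂ → M) : Prop where
  isCoveringMap : IsCoveringMap fun z : ball (0 : ℂ) 1 => h z
  surjOn : SurjOn h (ball 0 1) univ
  contMDiffOn : ContMDiffOn 𝓘(ℝ, ℂ) 𝓘(ℝ, ℂ) ∞ h (ball 0 1)
  conformalAt : ∀ z ∈ ball (0 : ℂ) 1, ∀ e ∈ atlas ℂ M, h z ∈ e.source → ConformalAt (e ∘ h) z

variable (M) in
/-- A (connected) conformal surface is hyperbolic if its universal conformal covering space is the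
disc. -/
def IsHyperbolicSurface : Prop :=
  ∃ h : ℂ → M, IsConformalDiscCovering h

/-- The Poincaré metric `|η| / (1 - |z|²)` of the unit disc. -/
def discPoincareMetric (z η : ℂ) : ℝ :=
  ‖η‖ / (1 - ‖z‖ ^ 2)

/-- The Poincaré metric of a hyperbolic conformal surface: the metric for which conformal coverings
`h : 𝔻 → M` are local isometries, that is, the length of `ξ ∈ T_p M` is the Poincaré length of any
vector `η ∈ T_z 𝔻` which is mapped to `(p, ξ)` by the differential of such an `h`. Since conformal
automorphisms of `𝔻` are isometries, all choices of `h`, `z`, `η` give the same length, so the set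
below has exactly one element if `M` is hyperbolic. -/
def poincareMetric (p : M) (ξ : TangentSpace 𝓘(ℝ, ℂ) p) : ℝ :=
  sInf {r : ℝ | ∃ (h : ℂ → M) (z : ℂ) (η : TangentSpace 𝓘(ℝ, ℂ) z),
    IsConformalDiscCovering h ∧ z ∈ ball (0 : ℂ) 1 ∧
    tangentMap 𝓘(ℝ, ℂ) 𝓘(ℝ, ℂ) h ⟨z, η⟩ = ⟨p, ξ⟩ ∧ r = discPoincareMetric z η}

variable {E : Type*} [NormedAddCommGroup E] [InnerProductSpace ℝ E]

/-- A map from a conformal surface to a Euclidean space is harmonic if it is harmonic in every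
conformal chart. -/
def IsHarmonicMap (f : M → E) : Prop :=
  ∀ e ∈ atlas ℂ M, InnerProductSpace.HarmonicOnNhd (f ∘ e.symm) e.target

/-- A differentiable map from a conformal surface to a Euclidean space is conformal (branch points
allowed) if in every conformal chart `x + iy` one has `|f_x| = |f_y|` and `f_x · f_y = 0`. -/
def IsConformalMapOnSurface (f : M → E) : Prop :=
  ∀ e ∈ atlas ℂ M, ∀ z ∈ e.target,
    DifferentiableAt ℝ (f ∘ e.symm) z ∧
    ‖fderiv ℝ (f ∘ e.symm) z 1‖ = ‖fderiv ℝ (f ∘ e.symm) z Complex.I‖ ∧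
    inner ℝ (fderiv ℝ (f ∘ e.symm) z 1) (fderiv ℝ (f ∘ e.symm) z Complex.I) = 0

/-- `f` is a conformal diffeomorphism of the surface `M` onto the subset `S` of a Euclidean space:
it is smooth with image `S`, it has a smooth inverse on `S`, and its differential is everywhere a
nonzero conformal linear map. -/
structure IsConformalDiffeoOnto (f : M → E) (S : Set E) : Prop where
  contMDiff : ContMDiff 𝓘(ℝ, ℂ) 𝓘(ℝ, E) ∞ f
  range_eq : range f = S
  exists_inverse : ∃ g : E → M,
    ContMDiffOn 𝓘(ℝ, E) 𝓘(ℝ, ℂ) ∞ g S ∧ Function.LeftInverse g f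
  conformalAt : ∀ e ∈ atlas ℂ M, ∀ z ∈ e.target, ConformalAt (f ∘ e.symm) z

end ConformalSurface

section Distance

variable {V : Type*} [NormedAddCommGroup V] [NormedSpace ℝ V]
  {N : Type*} [TopologicalSpace N] [ChartedSpace V N]

/-- The distance between `p` and `q` in the subset `S` of a manifold that is induced by a
(Riemannian or Finsler) metric `F`: the infimum of the `F`-lengths of the `C¹` paths in `S` from
`p` to `q`. -/
def metricEDist (F : ∀ p : N, TangentSpace 𝓘(ℝ, V) p → ℝ) (S : Set N) (p q : N) : ℝ≥0∞ :=
  ⨅ (γ : ℝ → N) (_ : ContMDiffOn 𝓘(ℝ, ℝ) 𝓘(ℝ, V) 1 γ (Icc 0 1)) (_ : MapsTo γ (Icc 0 1) S)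
    (_ : γ 0 = p) (_ : γ 1 = q),
    ∫⁻ t in Icc (0 : ℝ) 1,
      ENNReal.ofReal (F (γ t) (mfderivWithin 𝓘(ℝ, ℝ) 𝓘(ℝ, V) γ (Icc 0 1) t (1 : ℝ)))

end Distance

/-- The distance on a hyperbolic conformal surface induced by its Poincaré metric. -/
def poincareEDist {M : Type*} [TopologicalSpace M] [ChartedSpace ℂ M] (p q : M) : ℝ≥0∞ :=
  metricEDist (V := ℂ) (fun (p : M) ξ => poincareMetric p ξ) univ p q

/-- The Cayley–Klein metric of the unit ball of `ℝⁿ`. -/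
def cayleyKlein {n : ℕ} (x v : EuclideanSpace ℝ (Fin n)) : ℝ :=
  √(‖v‖ ^ 2 / (1 - ‖x‖ ^ 2) + (inner ℝ x v) ^ 2 / (1 - ‖x‖ ^ 2) ^ 2)

/-- The distance on the unit ball of `ℝⁿ` induced by the Cayley–Klein metric. -/
def cayleyKleinEDist {n : ℕ} (x y : EuclideanSpace ℝ (Fin n)) : ℝ≥0∞ :=
  metricEDist (V := EuclideanSpace ℝ (Fin n)) (fun x v => cayleyKlein x v) (ball 0 1) x y

/-- An affine disc in the unit ball of `ℝⁿ`: a nonempty intersection of the ball with an affine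
`2`-plane. -/
def IsAffineDisc {n : ℕ} (S : Set (EuclideanSpace ℝ (Fin n))) : Prop :=
  S.Nonempty ∧ ∃ A : AffineSubspace ℝ (EuclideanSpace ℝ (Fin n)),
    Module.finrank ℝ A.direction = 2 ∧ S = (A : Set (EuclideanSpace ℝ (Fin n))) ∩ ball 0 1

end

/-!
Let `F` be a harmonic map of the unit disc into the unit ball whose differential at `0` is `l • J`
with `l > 0` and `J` a linear isometry of `ℂ` into `E`. The affine disc through `F 0` parallel to the
image of `J` has a conformal parametrization `g = p + R J μ`, where `p ⊥ J`, `|p|² + R² = 1` and `μ` is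
the automorphism `z ↦ (z + b) / (1 + b̄ z)` of the disc, such that `g 0 = F 0` and
`dg₀ = R (1 - |b|²) J`. The unit circle is mapped by `g` into the unit sphere, so the defect
`1 - ⟪F, g⟫` is nonnegative. Multiplied by the weight `|1 + b̄ ζ|²`, the map `g` becomes a
trigonometric polynomial of degree one on the circle; so the weighted mean of the defect over the
circle of radius `r` depends only on `F 0` and `dF₀`, and equals `R (R (1 - |b|²) - r l)`
(`circleAverage_weighted_defect`). As `r → 1`, nonnegativity gives `l ≤ R (1 - |b|²)`. In case of
equality the defect tends to zero in the mean, and the Poisson formula gives `F = g`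
(`eq_discParam_of_scale_eq_at_zero`). Automorphisms of the disc transport this to any point, and
`l (1 - |z|²) ≤ R (1 - |b|²)` is the comparison of the Cayley–Klein and Poincaré metrics.

On a hyperbolic surface the map is composed with a conformal covering `h` by the disc; the
composition is harmonic and conformal, because conformal maps of plane domains are locally
holomorphic or antiholomorphic. The coverings are local isometries of the Poincaré metric
(`IsConformalDiscCovering.poincareMetric_eq`): two coverings lift through each other, and the lifts
are conformal self-maps of the disc, to which the above applies with `E = ℂ`. Integration along paths
gives the inequality of distances.

If the inequality of metrics were strict everywhere, it would be uniformly strict near `p`, and every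
path from `p` to `q ≠ p` would lose a fixed amount of length (`exists_length_gap`), so that the
distances could not be equal. No minimizing geodesics are needed. Hence either case of equality yields
equality of the metrics at some nonzero vector, so `f ∘ h` parametrizes an affine disc. Then `h` is
injective, hence a conformal diffeomorphism, and so is `f` onto the affine disc.
-/

noncomputable section

open InnerProductSpace Real Filter Topology

/-! ### Circle averages of harmonic functions -/

/-- The first Fourier coefficients of a harmonic function on a circle around the origin, in real
form: up to the factor `r² / 2` they are its partial derivatives at the centre. -/
theorem circleAverage_affine_mul {u : ℂ → ℝ} (hu : HarmonicOnNhd u (ball 0 1)) {r : ℝ}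
    (hr : 0 < r) (hr1 : r < 1) (α β γ : ℝ) :
    circleAverage (fun z : ℂ => (α + β * z.re + γ * z.im) * u z) 0 r =
      α * u 0 + r ^ 2 / 2 * (β * fderiv ℝ u 0 1 + γ * fderiv ℝ u 0 Complex.I) := by
  obtain ⟨Φ, hΦ, hu'⟩ := hu.exists_analyticOnNhd_ball_re_eq
  have hsub : closedBall (0 : ℂ) r ⊆ ball 0 1 := closedBall_subset_ball hr1
  have h0 : (0 : ℂ) ∈ ball (0 : ℂ) 1 := by simp
  have hd : DifferentiableOn ℂ Φ (closedBall 0 r) := hΦ.differentiableOn.mono hsub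
  have hdc : DiffContOnCl ℂ Φ (ball 0 r) :=
    (hd.mono (closure_ball_subset_closedBall)).diffContOnCl
  have hcont : ContinuousOn Φ (sphere 0 r) := hd.continuousOn.mono sphere_subset_closedBall
  have hne : ∀ z ∈ sphere (0 : ℂ) r, z ≠ 0 := fun z hz => ne_of_mem_sphere hz hr.ne'
  have e1 : circleAverage Φ 0 r = Φ 0 := by
    exact DiffContOnCl.circleAverage (by rwa [abs_of_pos hr])
  have e2 : circleAverage (fun z => z * Φ z) 0 r = 0 := by
    have h2 : DiffContOnCl ℂ (fun z => z * Φ z) (ball 0 r) :=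
      ((differentiable_id.differentiableOn.mul hd).mono
        closure_ball_subset_closedBall).diffContOnCl
    exact (DiffContOnCl.circleAverage (by rwa [abs_of_pos hr])).trans (zero_mul _)
  have e3 : circleAverage (fun z => z⁻¹ * Φ z) 0 r = deriv Φ 0 := by
    rw [circleAverage_eq_circleIntegral hr.ne', ← inv_smul_smul₀ Complex.two_pi_I_ne_zero
      (deriv Φ 0), ← hdc.deriv_eq_smul_circleIntegral hr]
    congr 1
    refine circleIntegral.integral_congr hr.le fun z hz => ?_
    have := hne z hz
    simp only [sub_zero, smul_eq_mul]
    field_simp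
  -- `β x + γ y` is the real part of `κ z`, and `z̄ = r² / z` on the circle
  set κ : ℂ := ⟨β, -γ⟩ with hκ
  have i1 : CircleIntegrable Φ 0 r := hcont.circleIntegrable hr.le
  have i2 : CircleIntegrable (fun z => z * Φ z) 0 r :=
    (continuousOn_id.mul hcont).circleIntegrable hr.le
  have i3 : CircleIntegrable (fun z => z⁻¹ * Φ z) 0 r :=
    ((continuousOn_id.inv₀ hne).mul hcont).circleIntegrable hr.le
  have key : circleAverage (fun z => (α : ℂ) • Φ z + ((κ / 2) • (z * Φ z) +
      ((starRingEnd ℂ) κ * r ^ 2 / 2) • (z⁻¹ * Φ z))) 0 r =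
      α * Φ 0 + (starRingEnd ℂ) κ * r ^ 2 / 2 * deriv Φ 0 := by
    rw [circleAverage_fun_add (i1.const_fun_smul)
        (f₂ := fun z => (κ / 2) • (z * Φ z) + ((starRingEnd ℂ) κ * r ^ 2 / 2) • (z⁻¹ * Φ z))
        ((i2.const_fun_smul).add (i3.const_fun_smul)),
      circleAverage_fun_add (i2.const_fun_smul) (i3.const_fun_smul),
      circleAverage_fun_smul, circleAverage_fun_smul, circleAverage_fun_smul, e1, e2, e3]
    simp
  have hre := Complex.reCLM.circleAverage_comp_comm (c := 0) (R := r)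
    (f := fun z => (α : ℂ) • Φ z + ((κ / 2) • (z * Φ z) +
      ((starRingEnd ℂ) κ * r ^ 2 / 2) • (z⁻¹ * Φ z)))
    (i1.const_fun_smul.add ((i2.const_fun_smul).add (i3.const_fun_smul)))
  rw [key] at hre
  have hder : HasDerivAt Φ (deriv Φ 0) 0 := (hΦ 0 h0).differentiableAt.hasDerivAt
  have hfd : HasFDerivAt u (Complex.reCLM.comp
      ((ContinuousLinearMap.toSpanSingleton ℂ (deriv Φ 0)).restrictScalars ℝ)) 0 := by
    have := Complex.reCLM.hasFDerivAt.comp (0 : ℂ) (hder.hasFDerivAt.restrictScalars ℝ)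
    refine this.congr_of_eventuallyEq ?_
    filter_upwards [isOpen_ball.mem_nhds h0] with z hz using (hu' hz).symm
  calc _ = circleAverage (Complex.reCLM ∘ fun z => (α : ℂ) • Φ z + ((κ / 2) • (z * Φ z) +
      ((starRingEnd ℂ) κ * r ^ 2 / 2) • (z⁻¹ * Φ z))) 0 r := by
        refine circleAverage_congr_sphere fun z hz => ?_
        rw [abs_of_pos hr] at hz
        have hz0 := hne z hz
        have hzb := hsub (sphere_subset_closedBall hz)
        have hinv : (r : ℂ) ^ 2 * z⁻¹ = (starRingEnd ℂ) z := by
          have : (r : ℂ) ^ 2 = (starRingEnd ℂ) z * z := by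
            rw [Complex.conj_mul']; simp at hz; simp [hz]
          rw [this, mul_assoc, mul_inv_cancel₀ hz0, mul_one]
        have : ((α : ℂ) • Φ z + ((κ / 2) • (z * Φ z) +
          ((starRingEnd ℂ) κ * r ^ 2 / 2) • (z⁻¹ * Φ z))) =
          ((α + β * z.re + γ * z.im : ℝ) : ℂ) * Φ z := by
          have h2 : ((β * z.re + γ * z.im : ℝ) : ℂ) =
              κ / 2 * z + (starRingEnd ℂ) κ / 2 * (starRingEnd ℂ) z := by
            apply Complex.ext <;> simp [hκ] <;> ring
          rw [add_assoc α, Complex.ofReal_add, h2, ← hinv]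
          simp only [smul_eq_mul]
          ring
        simp only [Function.comp_apply, this, Complex.reCLM_apply, Complex.re_ofReal_mul]
        rw [← hu' hzb]
    _ = _ := by
        rw [hre, hfd.fderiv, ← hu' h0]
        simp [hκ, ← Complex.ofReal_pow]
        ring

/-- The Cauchy–Schwarz inequality for circle averages, in the form
`2 d ≤ t + d² / t` with a free parameter `t`. -/
theorem circleAverage_le_half {d : ℂ → ℝ} {r t : ℝ} (hr : 0 < r) (ht : 0 < t)
    (hd : ContinuousOn d (sphere 0 r)) :
    circleAverage d 0 r ≤ (t + circleAverage (fun z => d z ^ 2) 0 r / t) / 2 := by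
  have i1 : CircleIntegrable d 0 r := hd.circleIntegrable hr.le
  have i2 : CircleIntegrable (fun z => d z ^ 2) 0 r := (hd.pow 2).circleIntegrable hr.le
  have ic : CircleIntegrable (fun _ : ℂ => t / 2) 0 r := continuousOn_const.circleIntegrable hr.le
  have : circleAverage (fun z => t / 2 + (1 / (2 * t)) • d z ^ 2) 0 r =
      (t + circleAverage (fun z => d z ^ 2) 0 r / t) / 2 := by
    rw [circleAverage_fun_add ic i2.const_fun_smul, circleAverage_const, circleAverage_fun_smul]
    simp only [smul_eq_mul]
    field_simp
  rw [← this]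
  refine circleAverage_mono i1 (ic.add i2.const_fun_smul) fun z _ => ?_
  have h : 0 ≤ (d z - t) ^ 2 / (2 * t) := by positivity
  have : t / 2 + (1 / (2 * t)) • d z ^ 2 - d z = (d z - t) ^ 2 / (2 * t) := by
    simp only [smul_eq_mul]; field_simp; ring
  linarith

/-- By the Poisson formula, a small mean of `|u|` over a circle makes `u` small inside. -/
theorem abs_le_circleAverage_abs {u : ℂ → ℝ} {r : ℝ} (hr : 0 < r)
    (hu : HarmonicOnNhd u (closedBall 0 r)) {w : ℂ} (hw : ‖w‖ < r) :
    |u w| ≤ (r + ‖w‖) / (r - ‖w‖) * circleAverage (fun z => |u z|) 0 r := by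
  have hw' : w ∈ ball (0 : ℂ) r := by simpa using hw
  have hc : ContinuousOn u (sphere 0 r) := hu.continuousOn.mono sphere_subset_closedBall
  have hk : ContinuousOn (poissonKernel 0 w) (sphere 0 r) := by
    rw [poissonKernel_eq_re_herglotzRieszKernel]
    have := continuousOn_herglotzRieszKernel_sphere hw'
    rw [abs_of_pos hr] at this
    exact Complex.continuous_re.comp_continuousOn this
  rw [← hu.circleAverage_poissonKernel_smul hw']
  refine abs_circleAverage_le_circleAverage_abs.trans ?_
  rw [← smul_eq_mul, ← circleAverage_fun_smul]
  refine circleAverage_mono ((hk.smul hc).abs.circleIntegrable hr.le)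
    (CircleIntegrable.const_fun_smul (hc.abs.circleIntegrable hr.le)) fun z hz => ?_
  rw [abs_of_pos hr] at hz
  have h1 := re_herglotzRieszKernel_le hz hw'
  have h2 := le_re_herglotzRieszKernel hz hw'
  simp only [sub_zero] at h1 h2
  have h3 : poissonKernel 0 w z = ((z + w) / (z - w)).re := by
    rw [poissonKernel_eq_re_herglotzRieszKernel]; simp [herglotzRieszKernel]
  have h4 : 0 ≤ (r - ‖w‖) / (r + ‖w‖) := div_nonneg (by linarith) (by positivity)
  change |poissonKernel 0 w z * u z| ≤ (r + ‖w‖) / (r - ‖w‖) * |u z|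
  rw [abs_mul]
  gcongr
  rw [h3, abs_of_nonneg (h4.trans h2)]
  exact h1

/-! ### Automorphisms of the disc -/

/-- The disc automorphism `z ↦ (z + b) / (1 + b̄ z)`, which maps `0` to `b`. -/
def discShift (b z : ℂ) : ℂ := (z + b) / (1 + (starRingEnd ℂ) b * z)

theorem one_add_conj_mul_ne_zero {b z : ℂ} (hb : ‖b‖ < 1) (hz : ‖z‖ ≤ 1) :
    1 + (starRingEnd ℂ) b * z ≠ 0 := by
  intro h
  have h1 : ‖(starRingEnd ℂ) b * z‖ = 1 := by
    rw [← norm_neg, ← eq_neg_of_add_eq_zero_left h]; simp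
  rw [norm_mul, Complex.norm_conj] at h1
  nlinarith [norm_nonneg b, norm_nonneg z]

theorem norm_sq_one_add_conj_mul {b ζ : ℂ} (hζ : ‖ζ‖ = 1) :
    ‖1 + (starRingEnd ℂ) b * ζ‖ ^ 2 = 1 + ‖b‖ ^ 2 + 2 * (b.re * ζ.re + b.im * ζ.im) := by
  have h : ζ.re * ζ.re + ζ.im * ζ.im = 1 := by
    rw [← Complex.normSq_apply, Complex.normSq_eq_norm_sq, hζ, one_pow]
  rw [Complex.sq_norm, Complex.sq_norm, Complex.normSq_apply, Complex.normSq_apply]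
  simp only [Complex.add_re, Complex.one_re, Complex.mul_re, Complex.conj_re, Complex.conj_im,
    Complex.add_im, Complex.one_im, Complex.mul_im]
  linear_combination (b.re * b.re + b.im * b.im) * h

/-- On the unit circle, the squared modulus of the denominator of `discShift b` clears the
denominator, and the result is a trigonometric polynomial of degree one. -/
theorem norm_sq_mul_discShift {b ζ : ℂ} (hb : ‖b‖ < 1) (hζ : ‖ζ‖ = 1) :
    ((‖1 + (starRingEnd ℂ) b * ζ‖ ^ 2 : ℝ) : ℂ) * discShift b ζ =
      ζ + 2 * b + b ^ 2 * (starRingEnd ℂ) ζ := by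
  have hne := one_add_conj_mul_ne_zero hb hζ.le
  have hz : ζ * (starRingEnd ℂ) ζ = 1 := by rw [Complex.mul_conj']; simp [hζ]
  have h2 : ((‖1 + (starRingEnd ℂ) b * ζ‖ ^ 2 : ℝ) : ℂ) =
      (1 + b * (starRingEnd ℂ) ζ) * (1 + (starRingEnd ℂ) b * ζ) := by
    rw [Complex.ofReal_pow, ← Complex.conj_mul']; simp
  rw [h2, discShift, mul_assoc, mul_div_cancel₀ _ hne]
  linear_combination b * hz

theorem one_sub_norm_sq_discShift {b z : ℂ} (hb : ‖b‖ < 1) (hz : ‖z‖ ≤ 1) :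
    1 - ‖discShift b z‖ ^ 2 =
      (1 - ‖b‖ ^ 2) * (1 - ‖z‖ ^ 2) / ‖1 + (starRingEnd ℂ) b * z‖ ^ 2 := by
  have hne := one_add_conj_mul_ne_zero hb hz
  have hne' : ‖1 + (starRingEnd ℂ) b * z‖ ^ 2 ≠ 0 := by simpa using hne
  rw [discShift, norm_div, div_pow, eq_div_iff hne', sub_mul, div_mul_cancel₀ _ hne']
  simp only [Complex.sq_norm, Complex.normSq_apply, Complex.add_re, Complex.one_re, Complex.mul_re,
    Complex.conj_re, Complex.conj_im, Complex.add_im, Complex.one_im, Complex.mul_im]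
  ring

theorem norm_discShift_lt_one {b z : ℂ} (hb : ‖b‖ < 1) (hz : ‖z‖ < 1) :
    ‖discShift b z‖ < 1 := by
  have h := one_sub_norm_sq_discShift hb hz.le
  have hne : 0 < ‖1 + (starRingEnd ℂ) b * z‖ := norm_pos_iff.2 (one_add_conj_mul_ne_zero hb hz.le)
  have h1 : 0 < 1 - ‖b‖ ^ 2 := by nlinarith [norm_nonneg b]
  have h2 : 0 < 1 - ‖z‖ ^ 2 := by nlinarith [norm_nonneg z]
  have : 0 < 1 - ‖discShift b z‖ ^ 2 := by rw [h]; positivity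
  nlinarith [norm_nonneg (discShift b z)]

theorem norm_discShift_eq_one {b z : ℂ} (hb : ‖b‖ < 1) (hz : ‖z‖ = 1) :
    ‖discShift b z‖ = 1 := by
  have h := one_sub_norm_sq_discShift hb hz.le
  rw [hz] at h
  simp only [one_pow, sub_self, mul_zero, zero_div] at h
  nlinarith [norm_nonneg (discShift b z)]

theorem discShift_neg_discShift {b z : ℂ} (hb : ‖b‖ < 1) (hz : ‖z‖ ≤ 1) :
    discShift (-b) (discShift b z) = z := by
  have hne := one_add_conj_mul_ne_zero hb hz
  have hbb : (1 : ℂ) - (starRingEnd ℂ) b * b ≠ 0 := by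
    rw [Complex.conj_mul', ← Complex.ofReal_pow, ← Complex.ofReal_one, ← Complex.ofReal_sub]
    have : (1 : ℝ) - ‖b‖ ^ 2 ≠ 0 := by nlinarith [norm_nonneg b]
    exact_mod_cast this
  have hd : 1 + (starRingEnd ℂ) (-b) * discShift b z =
      (1 - (starRingEnd ℂ) b * b) / (1 + (starRingEnd ℂ) b * z) := by
    rw [discShift, eq_div_iff hne, add_mul, mul_assoc, div_mul_cancel₀ _ hne, map_neg]
    ring
  have hn : discShift b z + -b =
      z * (1 - (starRingEnd ℂ) b * b) / (1 + (starRingEnd ℂ) b * z) := by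
    rw [discShift, eq_div_iff hne, add_mul, div_mul_cancel₀ _ hne]
    ring
  rw [discShift, hd, hn, div_div_div_cancel_right₀ hne, mul_div_assoc, div_self hbb, mul_one]

theorem analyticAt_discShift {b z : ℂ} (hb : ‖b‖ < 1) (hz : ‖z‖ ≤ 1) :
    AnalyticAt ℂ (discShift b) z := by
  have hne := one_add_conj_mul_ne_zero hb hz
  unfold discShift
  fun_prop (disch := assumption)

theorem discShift_zero_right (b : ℂ) : discShift b 0 = b := by simp [discShift]

/-- The holomorphic automorphism of the disc which is the composition of two shifts. For
`a = -z₀` it maps `z₀` to `b`. -/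
def discAut (b a z : ℂ) : ℂ := discShift b (discShift a z)

theorem norm_discAut_lt_one {a b z : ℂ} (hb : ‖b‖ < 1) (ha : ‖a‖ < 1) (hz : ‖z‖ < 1) : ‖discAut b a z‖ < 1 :=
  norm_discShift_lt_one hb (norm_discShift_lt_one ha hz)

theorem discAut_neg_discAut {a b z : ℂ} (hb : ‖b‖ < 1) (ha : ‖a‖ < 1) (hz : ‖z‖ < 1) :
    discAut (-a) (-b) (discAut b a z) = z := by
  rw [discAut, discAut, discShift_neg_discShift hb (norm_discShift_lt_one ha hz).le,
    discShift_neg_discShift ha hz.le]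

theorem analyticAt_discAut {a b z : ℂ} (hb : ‖b‖ < 1) (ha : ‖a‖ < 1) (hz : ‖z‖ < 1) :
    AnalyticAt ℂ (discAut b a) z :=
  (analyticAt_discShift hb (norm_discShift_lt_one ha hz).le).comp (analyticAt_discShift ha hz.le)

theorem conformalAt_discAut {a b z : ℂ} (hb : ‖b‖ < 1) (ha : ‖a‖ < 1) (hz : ‖z‖ < 1) :
    ConformalAt (discAut b a) z := by
  have h1 := (analyticAt_discAut hb ha hz).differentiableAt
  have hb' : ‖-b‖ < 1 := by rwa [norm_neg]
  have ha' : ‖-a‖ < 1 := by rwa [norm_neg]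
  have h2 := (analyticAt_discAut ha' hb' (norm_discAut_lt_one hb ha hz)).differentiableAt
  refine h1.conformalAt fun h0 => ?_
  have h3 : discAut (-a) (-b) ∘ discAut b a =ᶠ[𝓝 z] id := by
    filter_upwards [isOpen_ball.mem_nhds (mem_ball_zero_iff.2 hz)] with w hw
    exact discAut_neg_discAut hb ha (mem_ball_zero_iff.1 hw)
  have h4 := h3.deriv_eq
  rw [deriv_comp z h2 h1, h0, mul_zero, deriv_id] at h4
  exact zero_ne_one h4

theorem hasDerivAt_discShift_zero (b : ℂ) : HasDerivAt (discShift b) (1 - ‖b‖ ^ 2 : ℝ) 0 := by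
  have h1 : HasDerivAt (fun z : ℂ => z + b) 1 0 := (hasDerivAt_id 0).add_const b
  have h2 : HasDerivAt (fun z : ℂ => 1 + (starRingEnd ℂ) b * z) ((starRingEnd ℂ) b) 0 := by
    simpa using ((hasDerivAt_id (0 : ℂ)).const_mul ((starRingEnd ℂ) b)).const_add 1
  have := h1.div h2 (by simp)
  refine this.congr_deriv ?_
  simp [← Complex.mul_conj']

/-! ### The Schwarz lemma at the origin -/

section InnerProductSpace

variable {E : Type*} [NormedAddCommGroup E] [InnerProductSpace ℝ E]

theorem linearIsometry_complex_apply (J : ℂ →ₗᵢ[ℝ] E) (w : ℂ) :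
    J w = w.re • J 1 + w.im • J Complex.I := by
  conv_lhs => rw [show w = w.re • (1 : ℂ) + w.im • Complex.I by simp]
  rw [map_add, J.map_smul, J.map_smul]

/-- The weighted integral mean, over the circle of radius `r`, of the defect `1 - ⟪F, g⟫`, where
`g = p + R J (discShift b ·)` is the conformal parametrization of an affine disc with the same value
and a parallel differential at the origin. The weight `|1 + b̄ ζ|²` turns `g` into a trigonometric
polynomial of degree one, so only the value and the first derivatives of `F` at `0` enter. -/
theorem circleAverage_weighted_defect {F : ℂ → E} (hF : HarmonicOnNhd F (ball 0 1))
    {p : E} {R l : ℝ} {J : ℂ →ₗᵢ[ℝ] E} {b : ℂ} (hpJ : ∀ w, inner ℝ p (J w) = 0)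
    (hpR : ‖p‖ ^ 2 + R ^ 2 = 1) (hb : ‖b‖ < 1) (hF0 : F 0 = p + R • J b)
    (hdF : fderiv ℝ F 0 = l • J.toContinuousLinearMap) {r : ℝ} (hr : 0 < r) (hr1 : r < 1) :
    circleAverage (fun z : ℂ => ‖1 + (starRingEnd ℂ) b * (z / r)‖ ^ 2 *
      (1 - inner ℝ (F z) (p + R • J (discShift b (z / r))))) 0 r =
      R * (R * (1 - ‖b‖ ^ 2) - r * l) := by
  have h0 : (0 : ℂ) ∈ ball (0 : ℂ) 1 := by simp
  have hFd : DifferentiableAt ℝ F 0 := (hF 0 h0).1.differentiableAt two_ne_zero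
  have hJJ : ∀ v w : ℂ, inner ℝ (J v) (J w) = v.re * w.re + v.im * w.im := by
    intro v w
    rw [J.inner_map_map, Complex.inner]
    simp [mul_comm]
  have hu : ∀ v : E, HarmonicOnNhd (fun z => inner ℝ v (F z)) (ball 0 1) := fun v =>
    hF.comp_CLM (innerSL ℝ v)
  have hu0 : ∀ v : E, fderiv ℝ (fun z => inner ℝ v (F z)) 0 =
      (innerSL ℝ v).comp (l • J.toContinuousLinearMap) := fun v => by
    rw [← hdF]
    exact ((innerSL ℝ v).hasFDerivAt.comp 0 hFd.hasFDerivAt).fderiv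
  have hS : sphere (0 : ℂ) r ⊆ ball 0 1 := sphere_subset_closedBall.trans (closedBall_subset_ball hr1)
  have hci : ∀ {u : ℂ → ℝ}, HarmonicOnNhd u (ball 0 1) → ∀ α β γ : ℝ,
      CircleIntegrable (fun z : ℂ => (α + β * z.re + γ * z.im) * u z) 0 r := by
    intro u hu α β γ
    refine ContinuousOn.circleIntegrable hr.le ?_
    exact (by fun_prop : Continuous fun z : ℂ => (α + β * z.re + γ * z.im)).continuousOn.mul
      (hu.continuousOn.mono hS)
  have hone : HarmonicOnNhd (fun _ : ℂ => (1 : ℝ)) (ball 0 1) := harmonicOnNhd_const 1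
  have e0 := circleAverage_affine_mul hone hr hr1 (1 + ‖b‖ ^ 2) (2 * b.re / r) (2 * b.im / r)
  have ep := circleAverage_affine_mul (hu p) hr hr1 (1 + ‖b‖ ^ 2) (2 * b.re / r) (2 * b.im / r)
  have e1 := circleAverage_affine_mul (hu (J 1)) hr hr1 (R * (2 * b.re))
    (R * (1 + b.re ^ 2 - b.im ^ 2) / r) (R * (2 * b.re * b.im) / r)
  have e2 := circleAverage_affine_mul (hu (J Complex.I)) hr hr1 (R * (2 * b.im))
    (R * (2 * b.re * b.im) / r) (R * (1 - b.re ^ 2 + b.im ^ 2) / r)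
  have i0 := hci hone (1 + ‖b‖ ^ 2) (2 * b.re / r) (2 * b.im / r)
  have ip := hci (hu p) (1 + ‖b‖ ^ 2) (2 * b.re / r) (2 * b.im / r)
  have i1 := hci (hu (J 1)) (R * (2 * b.re))
    (R * (1 + b.re ^ 2 - b.im ^ 2) / r) (R * (2 * b.re * b.im) / r)
  have i2 := hci (hu (J Complex.I)) (R * (2 * b.im))
    (R * (2 * b.re * b.im) / r) (R * (1 - b.re ^ 2 + b.im ^ 2) / r)
  have hsum := circleAverage_sub (i0.sub ip) (i1.add i2)
  rw [circleAverage_sub i0 ip, circleAverage_add i1 i2, e0, ep, e1, e2] at hsum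
  have hb2 : ‖b‖ ^ 2 = b.re ^ 2 + b.im ^ 2 := by
    rw [Complex.sq_norm, Complex.normSq_apply]; ring
  calc _ = _ := circleAverage_congr_sphere fun z hz => ?_
    _ = _ := hsum
    _ = _ := ?_
  · rw [abs_of_pos hr] at hz
    have hz' : ‖z‖ = r := by simpa using hz
    have hr' : (r : ℂ) ≠ 0 := by exact_mod_cast hr.ne'
    have hζ : ‖z / r‖ = 1 := by
      rw [norm_div, hz', Complex.norm_real, Real.norm_of_nonneg hr.le, div_self hr.ne']
    have hsh := norm_sq_mul_discShift hb hζ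
    have hre : (z / r).re = z.re / r := Complex.div_ofReal_re z r
    have him : (z / r).im = z.im / r := Complex.div_ofReal_im z r
    have hN : ‖1 + (starRingEnd ℂ) b * (z / r)‖ ^ 2 • J (discShift b (z / r)) =
        J (z / r + 2 * b + b ^ 2 * (starRingEnd ℂ) (z / r)) := by
      rw [← hsh, ← J.map_smul, Complex.real_smul]
    have hin : ‖1 + (starRingEnd ℂ) b * (z / r)‖ ^ 2 *
        inner ℝ (F z) (J (discShift b (z / r))) =
        inner ℝ (F z) (J (z / r + 2 * b + b ^ 2 * (starRingEnd ℂ) (z / r))) := by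
      rw [← hN, inner_smul_right]
    rw [inner_add_right, inner_smul_right]
    have : ‖1 + (starRingEnd ℂ) b * (z / r)‖ ^ 2 *
      (1 - (inner ℝ (F z) p + R * inner ℝ (F z) (J (discShift b (z / r))))) =
      ‖1 + (starRingEnd ℂ) b * (z / r)‖ ^ 2 * 1 - ‖1 + (starRingEnd ℂ) b * (z / r)‖ ^ 2 *
        inner ℝ (F z) p - R * (‖1 + (starRingEnd ℂ) b * (z / r)‖ ^ 2 *
        inner ℝ (F z) (J (discShift b (z / r)))) := by ring
    rw [this, hin, linearIsometry_complex_apply J (_ + _ + _), norm_sq_one_add_conj_mul hζ,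
      inner_add_right, inner_smul_right, inner_smul_right, real_inner_comm (J 1),
      real_inner_comm (J Complex.I), real_inner_comm p]
    simp only [Pi.sub_apply, Pi.add_apply, Complex.add_re, Complex.add_im, Complex.mul_re,
      Complex.mul_im, Complex.conj_re, Complex.conj_im, hre, him, pow_two,
      Complex.re_ofNat, Complex.im_ofNat]
    field_simp
    ring
  · simp only [hu0, hF0, ContinuousLinearMap.comp_apply, smul_apply,
      LinearIsometry.coe_toContinuousLinearMap, innerSL_apply_apply, inner_smul_right, hpJ,
      inner_add_right, hJJ, real_inner_comm p, real_inner_self_eq_norm_sq]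
    simp only [hb2, Complex.one_re, Complex.one_im, Complex.I_re, Complex.I_im, show ‖p‖ ^ 2 = 1 - R ^ 2 by linarith]
    simp
    field_simp
    ring

theorem norm_sq_add_smul_isometry {p : E} {J : ℂ →ₗᵢ[ℝ] E} (hpJ : ∀ w, inner ℝ p (J w) = 0)
    (R : ℝ) (w : ℂ) : ‖p + R • J w‖ ^ 2 = ‖p‖ ^ 2 + R ^ 2 * ‖w‖ ^ 2 := by
  rw [norm_add_sq_real, inner_smul_right, hpJ, norm_smul, J.norm_map, mul_pow, Real.norm_eq_abs,
    sq_abs]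
  ring

/-- On the unit circle the parametrization of the affine disc has unit length, so the defect
`1 - ⟪y, g⟫` controls the distance of `y` from it. -/
theorem norm_sub_discParam_sq_le {p : E} {R : ℝ} {J : ℂ →ₗᵢ[ℝ] E} {b ζ : ℂ}
    (hpJ : ∀ w, inner ℝ p (J w) = 0) (hpR : ‖p‖ ^ 2 + R ^ 2 = 1) (hb : ‖b‖ < 1) (hζ : ‖ζ‖ = 1)
    {y : E} (hy : ‖y‖ ≤ 1) :
    ‖y - (p + R • J (discShift b ζ))‖ ^ 2 ≤
      2 * (1 - inner ℝ y (p + R • J (discShift b ζ))) := by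
  have hg : ‖p + R • J (discShift b ζ)‖ ^ 2 = 1 := by
    rw [norm_sq_add_smul_isometry hpJ, norm_discShift_eq_one hb hζ]; linarith
  rw [norm_sub_sq_real, hg]
  nlinarith [norm_nonneg y]

theorem norm_div_ofReal_eq_one {z : ℂ} {r : ℝ} (hr : 0 < r) (hz : ‖z‖ = r) : ‖z / r‖ = 1 := by
  rw [norm_div, hz, Complex.norm_real, Real.norm_of_nonneg hr.le, div_self hr.ne']

/-- The Schwarz lemma at the origin: the differential of `F` is not larger than that of the conformal
parametrization of the affine disc with the same value and tangent plane. -/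
theorem differential_scale_le_at_zero {F : ℂ → E} (hF : HarmonicOnNhd F (ball 0 1))
    (hF1 : ∀ z ∈ ball (0 : ℂ) 1, ‖F z‖ < 1)
    {p : E} {R l : ℝ} {J : ℂ →ₗᵢ[ℝ] E} {b : ℂ} (hpJ : ∀ w, inner ℝ p (J w) = 0)
    (hR : 0 < R) (hpR : ‖p‖ ^ 2 + R ^ 2 = 1) (hb : ‖b‖ < 1) (hF0 : F 0 = p + R • J b)
    (hdF : fderiv ℝ F 0 = l • J.toContinuousLinearMap) :
    l ≤ R * (1 - ‖b‖ ^ 2) := by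
  have key : ∀ r ∈ Ioo (0 : ℝ) 1, r * l ≤ R * (1 - ‖b‖ ^ 2) := by
    rintro r ⟨hr, hr1⟩
    have h := circleAverage_weighted_defect hF hpJ hpR hb hF0 hdF hr hr1
    have h2 : 0 ≤ R * (R * (1 - ‖b‖ ^ 2) - r * l) := by
      rw [← h]
      refine circleAverage_nonneg_of_nonneg fun z hz => ?_
      rw [abs_of_pos hr] at hz
      have hz' : ‖z‖ = r := by simpa using hz
      have hy : ‖F z‖ ≤ 1 := (hF1 z (by simpa [hz'] using hr1)).le
      have := norm_sub_discParam_sq_le hpJ hpR hb (norm_div_ofReal_eq_one hr hz') hy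
      have h3 := sq_nonneg ‖F z - (p + R • J (discShift b (z / r)))‖
      exact mul_nonneg (sq_nonneg _) (by linarith)
    have := nonneg_of_mul_nonneg_right h2 hR
    linarith
  have ht : Tendsto (fun r : ℝ => r * l) (𝓝[<] 1) (𝓝 (1 * l)) :=
    ((continuous_id.mul continuous_const).tendsto 1).mono_left nhdsWithin_le_nhds
  rw [one_mul] at ht
  exact le_of_tendsto ht (mem_of_superset (Ioo_mem_nhdsLT zero_lt_one) key)

/-- Rigidity in the Schwarz lemma at the origin: as `r → 1`, the defect tends to zero in the mean
over circles of radius `r`, so `F` agrees with the parametrization of the affine disc by the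
Poisson formula. -/
theorem eq_discParam_of_scale_eq_at_zero {F : ℂ → E} (hF : HarmonicOnNhd F (ball 0 1))
    (hF1 : ∀ z ∈ ball (0 : ℂ) 1, ‖F z‖ < 1)
    {p : E} {R l : ℝ} {J : ℂ →ₗᵢ[ℝ] E} {b : ℂ} (hpJ : ∀ w, inner ℝ p (J w) = 0)
    (hpR : ‖p‖ ^ 2 + R ^ 2 = 1) (hb : ‖b‖ < 1) (hF0 : F 0 = p + R • J b)
    (hdF : fderiv ℝ F 0 = l • J.toContinuousLinearMap) (hl : l = R * (1 - ‖b‖ ^ 2))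
    {w : ℂ} (hw : ‖w‖ < 1) : F w = p + R • J (discShift b w) := by
  set g : ℂ → E := fun z => p + R • J (discShift b z) with hg
  have hgan : ∀ z : ℂ, ‖z‖ ≤ 1 → ContinuousAt g z := fun z hz =>
    continuousAt_const.add ((J.continuous.continuousAt.comp
      (analyticAt_discShift hb hz).continuousAt).const_smul R)
  suffices H : ∀ v : E, |inner ℝ v (F w - g w)| ≤ 0 by
    rw [← sub_eq_zero]
    exact ext_inner_left ℝ fun v => by
      rw [inner_zero_right]; exact abs_nonpos_iff.1 (H v)
  intro v
  set C : ℝ := ‖v‖ ^ 2 * (2 / (1 - ‖b‖) ^ 2) * (R * l) with hC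
  have hb1 : 0 < 1 - ‖b‖ := by linarith
  have key : ∀ r ∈ Ioo (‖w‖ : ℝ) 1, |inner ℝ v (F w - g (w / r))| ≤
      (r + ‖w‖) / (r - ‖w‖) * (√(1 - r) * (1 + C) / 2) := by
    rintro r ⟨hwr, hr1⟩
    have hr : 0 < r := (norm_nonneg w).trans_lt hwr
    have hr' : (r : ℂ) ≠ 0 := by exact_mod_cast hr.ne'
    have hu : HarmonicOnNhd (fun z : ℂ => (inner ℝ v (F z - g (z / r)) : ℝ)) (closedBall 0 r) := by
      intro z hz
      have hz' : ‖z‖ ≤ r := by simpa using hz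
      have hzr : ‖z / r‖ ≤ 1 := by
        rw [norm_div, Complex.norm_real, Real.norm_of_nonneg hr.le]
        exact div_le_one_of_le₀ hz' hr.le
      have han : AnalyticAt ℂ (fun z : ℂ => discShift b (z / r)) z :=
        (analyticAt_discShift hb hzr).comp_of_eq (f := fun z : ℂ => z / r)
          (by fun_prop (disch := assumption)) rfl
      have h1 : HarmonicAt (fun z : ℂ => R • J (discShift b (z / r))) z :=
        han.harmonicAt.comp_CLM (R • J.toContinuousLinearMap)
      have h2 : HarmonicAt (fun z : ℂ => g (z / r)) z :=
        ((harmonicOnNhd_const (s := univ) p) z trivial).add h1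
      exact ((hF z (closedBall_subset_ball hr1 hz)).sub h2).comp_CLM (innerSL ℝ v)
    have h1 := abs_le_circleAverage_abs hr hu hwr
    have hcont : ContinuousOn (fun z : ℂ => (inner ℝ v (F z - g (z / r)) : ℝ)) (sphere 0 r) :=
      hu.continuousOn.mono sphere_subset_closedBall
    -- the mean of `‖F - g‖²` is `O(1 - r)`, so the parameter of size `√(1 - r)` is optimal
    have ht : 0 < √(1 - r) := Real.sqrt_pos.2 (by linarith)
    have h2 := circleAverage_le_half hr ht hcont.abs
    have hFc : ContinuousOn F (sphere 0 r) :=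
      hF.continuousOn.mono (sphere_subset_closedBall.trans (closedBall_subset_ball hr1))
    have hgc : ContinuousOn (fun z : ℂ => g (z / r)) (sphere 0 r) := fun z hz =>
      ContinuousAt.continuousWithinAt (ContinuousAt.comp (f := fun z : ℂ => z / r)
        (hgan (z / r) (norm_div_ofReal_eq_one hr (by simpa using hz)).le)
        (by fun_prop (disch := assumption)))
    have h3 : circleAverage (fun z : ℂ => |(inner ℝ v (F z - g (z / r)) : ℝ)| ^ 2) 0 r ≤
        C * (1 - r) := by
      have hav := circleAverage_weighted_defect hF hpJ hpR hb hF0 hdF hr hr1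
      have : C * (1 - r) = circleAverage (fun z : ℂ => (‖v‖ ^ 2 * (2 / (1 - ‖b‖) ^ 2)) •
          (‖1 + (starRingEnd ℂ) b * (z / r)‖ ^ 2 *
            (1 - inner ℝ (F z) (p + R • J (discShift b (z / r)))))) 0 r := by
        rw [circleAverage_fun_smul, hav, ← hl, hC, smul_eq_mul]; ring
      rw [this]
      refine circleAverage_mono ((hcont.abs.pow 2).circleIntegrable hr.le)
        (CircleIntegrable.const_fun_smul (ContinuousOn.circleIntegrable hr.le ?_)) fun z hz => ?_
      · refine ContinuousOn.mul (by fun_prop) (continuousOn_const.sub (hFc.inner hgc))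
      · rw [abs_of_pos hr] at hz
        have hz' : ‖z‖ = r := by simpa using hz
        have hζ := norm_div_ofReal_eq_one hr hz'
        have hy : ‖F z‖ ≤ 1 := (hF1 z (by simpa [hz'] using hr1)).le
        have hd := norm_sub_discParam_sq_le hpJ hpR hb hζ hy
        have hρ : (1 - ‖b‖) ^ 2 ≤ ‖1 + (starRingEnd ℂ) b * (z / r)‖ ^ 2 := by
          have : 1 - ‖b‖ ≤ ‖1 + (starRingEnd ℂ) b * (z / r)‖ := by
            have := norm_sub_le_norm_add (1 : ℂ) ((starRingEnd ℂ) b * (z / r))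
            rwa [norm_mul, hζ, Complex.norm_conj, norm_one, mul_one] at this
          gcongr
        have hcs : |(inner ℝ v (F z - g (z / r)) : ℝ)| ≤ ‖v‖ * ‖F z - g (z / r)‖ :=
          abs_real_inner_le_norm _ _
        set δ : ℝ := 1 - inner ℝ (F z) (p + R • J (discShift b (z / r))) with hδ
        have hδ0 : 0 ≤ δ := by
          have := sq_nonneg ‖F z - (p + R • J (discShift b (z / r)))‖
          linarith
        calc |(inner ℝ v (F z - g (z / r)) : ℝ)| ^ 2 ≤ (‖v‖ * ‖F z - g (z / r)‖) ^ 2 := by gcongr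
          _ = ‖v‖ ^ 2 * ‖F z - g (z / r)‖ ^ 2 := mul_pow _ _ _
          _ ≤ ‖v‖ ^ 2 * (2 * δ) := by gcongr
          _ = ‖v‖ ^ 2 * (2 / (1 - ‖b‖) ^ 2) * ((1 - ‖b‖) ^ 2 * δ) := by field_simp
          _ ≤ ‖v‖ ^ 2 * (2 / (1 - ‖b‖) ^ 2) *
            (‖1 + (starRingEnd ℂ) b * (z / r)‖ ^ 2 * δ) := by gcongr
    refine h1.trans ?_
    have hpos : 0 ≤ (r + ‖w‖) / (r - ‖w‖) := div_nonneg (by positivity) (by linarith)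
    refine mul_le_mul_of_nonneg_left (h2.trans ?_) hpos
    have : C * (1 - r) / √(1 - r) = C * √(1 - r) := by
      rw [mul_div_assoc, Real.div_sqrt]
    have h4 := div_le_div_of_nonneg_right h3 ht.le
    linarith
  have hgw : Tendsto (fun r : ℝ => |inner ℝ v (F w - g (w / r))|) (𝓝[<] 1)
      (𝓝 |inner ℝ v (F w - g w)|) := by
    have h1 : Tendsto (fun r : ℝ => w / r) (𝓝[<] 1) (𝓝 w) := by
      have : ContinuousAt (fun r : ℝ => w / r) 1 :=
        continuousAt_const.div Complex.continuous_ofReal.continuousAt (by simp)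
      have h := this.tendsto
      simp only [Complex.ofReal_one, div_one] at h
      exact h.mono_left nhdsWithin_le_nhds
    exact (tendsto_const_nhds.inner (tendsto_const_nhds.sub ((hgan w hw.le).tendsto.comp h1))).abs
  have hz : Tendsto (fun r : ℝ => (r + ‖w‖) / (r - ‖w‖) * (√(1 - r) * (1 + C) / 2)) (𝓝[<] 1)
      (𝓝 0) := by
    have : ContinuousAt (fun r : ℝ => (r + ‖w‖) / (r - ‖w‖) * (√(1 - r) * (1 + C) / 2)) 1 := by
      have : (1 : ℝ) - ‖w‖ ≠ 0 := by linarith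
      fun_prop (disch := assumption)
    have h := this.tendsto
    simp only [sub_self, Real.sqrt_zero, zero_mul, zero_div, mul_zero] at h
    exact h.mono_left nhdsWithin_le_nhds
  exact le_of_tendsto_of_tendsto hgw hz (mem_of_superset (Ioo_mem_nhdsLT hw) key)

/-! ### Harmonic functions and conformal maps -/

theorem ConformalAt.fderiv_I_eq {k : ℂ → ℂ} {z : ℂ} (h : ConformalAt k z) :
    fderiv ℝ k z 1 ≠ 0 ∧ (fderiv ℝ k z Complex.I = Complex.I * fderiv ℝ k z 1 ∨
      fderiv ℝ k z Complex.I = -(Complex.I * fderiv ℝ k z 1)) := by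
  rw [conformalAt_iff_isConformalMap_fderiv] at h
  refine ⟨fun h0 => one_ne_zero (h.injective (h0.trans (map_zero _).symm)), ?_⟩
  rcases h.is_complex_or_conj_linear with ⟨m, hm⟩ | ⟨m, hm⟩
  · left
    rw [← hm, ContinuousLinearMap.coe_restrictScalars']
    simpa using m.map_smul Complex.I 1
  · right
    have h1 : fderiv ℝ k z 1 = m 1 := by
      have := congrArg (fun L => L 1) hm
      simpa using this.symm
    have h2 : fderiv ℝ k z Complex.I = -m Complex.I := by
      have := congrArg (fun L => L Complex.I) hm
      simp at this
      rw [this, neg_neg]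
    rw [h1, h2]
    simpa using m.map_smul Complex.I 1

/-- A `C¹` map between plane domains which is conformal near a point is holomorphic or
antiholomorphic near that point: the sign of the Jacobian is locally constant. -/
theorem analyticAt_or_analyticAt_conj_of_conformalAt {k : ℂ → ℂ} {z : ℂ}
    (hk : ContDiffAt ℝ 1 k z) (hc : ∀ᶠ w in 𝓝 z, ConformalAt k w) :
    AnalyticAt ℂ k z ∨ AnalyticAt ℂ (fun w => (starRingEnd ℂ) (k w)) z := by
  -- the Jacobian determinant of `k`
  set d : ℂ → ℝ := fun w => ((starRingEnd ℂ) (fderiv ℝ k w 1) * fderiv ℝ k w Complex.I).im with hd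
  have hcont : ContinuousAt d z := by
    have h1 : ContinuousAt (fderiv ℝ k) z := (hk.fderiv_right (m := 0) le_rfl).continuousAt
    have h2 : ∀ v : ℂ, ContinuousAt (fun w => fderiv ℝ k w v) z := fun v =>
      h1.clm_apply continuousAt_const
    exact Complex.continuous_im.continuousAt.comp
      ((Complex.continuous_conj.continuousAt.comp (h2 1)).mul (h2 Complex.I))
  have hpos : ∀ a : ℂ, ((starRingEnd ℂ) a * (Complex.I * a)).im = ‖a‖ ^ 2 := fun a => by
    rw [mul_left_comm, Complex.conj_mul', ← Complex.ofReal_pow]; simp [-Complex.ofReal_pow]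
  have key : ∀ w, ConformalAt k w → (0 < d w ∧ fderiv ℝ k w Complex.I = Complex.I * fderiv ℝ k w 1) ∨
      (d w < 0 ∧ fderiv ℝ k w Complex.I = -(Complex.I * fderiv ℝ k w 1)) := by
    intro w hw
    obtain ⟨hne, h | h⟩ := hw.fderiv_I_eq
    · refine Or.inl ⟨?_, h⟩
      rw [hd]; simp only [h, hpos]; positivity
    · refine Or.inr ⟨?_, h⟩
      rw [hd]; simp only [h, mul_neg, Complex.neg_im, hpos]
      have := norm_pos_iff.2 hne
      simp only [Left.neg_neg_iff]; positivity
  rcases key z hc.self_of_nhds with ⟨hz, -⟩ | ⟨hz, -⟩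
  · left
    have hev : ∀ᶠ w in 𝓝 z, DifferentiableAt ℂ k w := by
      filter_upwards [hc, hcont.eventually (lt_mem_nhds hz)] with w hw hdw
      rcases key w hw with ⟨-, h⟩ | ⟨h, -⟩
      · exact differentiableAt_complex_iff_differentiableAt_real.2
          ⟨hw.differentiableAt, by rw [h, smul_eq_mul]⟩
      · exact absurd h hdw.not_gt
    exact Complex.analyticAt_iff_eventually_differentiableAt.2 hev
  · right
    have hev : ∀ᶠ w in 𝓝 z, DifferentiableAt ℂ (fun w => (starRingEnd ℂ) (k w)) w := by
      filter_upwards [hc, hcont.eventually (gt_mem_nhds hz)] with w hw hdw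
      rcases key w hw with ⟨h, -⟩ | ⟨-, h⟩
      · exact absurd h hdw.not_gt
      · have hcd : HasFDerivAt (fun w => (starRingEnd ℂ) (k w))
            ((Complex.conjCLE : ℂ →L[ℝ] ℂ).comp (fderiv ℝ k w)) w :=
          (Complex.conjCLE : ℂ →L[ℝ] ℂ).hasFDerivAt.comp w hw.differentiableAt.hasFDerivAt
        refine differentiableAt_complex_iff_differentiableAt_real.2 ⟨hcd.differentiableAt, ?_⟩
        rw [hcd.fderiv]
        simp [h]
    exact Complex.analyticAt_iff_eventually_differentiableAt.2 hev

/-- Harmonicity of vector-valued maps can be tested on the scalar components. -/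
theorem harmonicAt_of_forall_inner {f : ℂ → E} {z : ℂ} (hf : ContDiffAt ℝ 2 f z)
    (h : ∀ᶠ w in 𝓝 z, ∀ v : E, HarmonicAt (fun y => (inner ℝ v (f y) : ℝ)) w) :
    HarmonicAt f z := by
  refine ⟨hf, ?_⟩
  filter_upwards [h, hf.eventually (by simp)] with w hw hfw
  refine ext_inner_left ℝ fun v => ?_
  have h1 := hfw.laplacian_CLM_comp_left (l := innerSL ℝ v)
  have h2 := (hw v).2.self_of_nhds
  rw [Pi.zero_apply, inner_zero_right, ← innerSL_apply_apply ℝ v]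
  exact h1.symm.trans h2

theorem exists_analyticAt_re_eventuallyEq {u : ℂ → ℝ} {z : ℂ} (hu : HarmonicAt u z) :
    ∃ Φ : ℂ → ℂ, AnalyticAt ℂ Φ z ∧ u =ᶠ[𝓝 z] fun w => (Φ w).re := by
  obtain ⟨ε, hε, h⟩ := isOpen_iff.1 (isOpen_setOfPred_harmonicAt (f := u)) z hu
  obtain ⟨Φ, h1, h2⟩ := InnerProductSpace.HarmonicOnNhd.exists_analyticOnNhd_ball_re_eq
    (fun _ hy ↦ h hy)
  exact ⟨Φ, h1 z (mem_ball_self hε), (h2.symm.eventuallyEq_of_mem (ball_mem_nhds z hε))⟩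

theorem InnerProductSpace.HarmonicAt.comp_analyticAt {f : ℂ → E} {k : ℂ → ℂ} {z : ℂ} (hf : HarmonicAt f (k z))
    (hk : AnalyticAt ℂ k z) : HarmonicAt (fun w => f (k w)) z := by
  have hkr : ContDiffAt ℝ 2 k z := hk.contDiffAt.restrict_scalars ℝ
  refine harmonicAt_of_forall_inner (ContDiffAt.comp z hf.1 hkr) ?_
  filter_upwards [hk.continuousAt.eventually hf.eventually, hk.eventually_analyticAt] with w hw hkw v
  obtain ⟨Φ, h1, h2⟩ := exists_analyticAt_re_eventuallyEq (hw.comp_CLM (innerSL ℝ v))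
  have h3 : (fun y => (inner ℝ v (f (k y)) : ℝ)) =ᶠ[𝓝 w] fun y => (Φ (k y)).re :=
    h2.comp_tendsto hkw.continuousAt
  rw [harmonicAt_congr_nhds h3]
  exact (h1.comp hkw).harmonicAt_re

theorem InnerProductSpace.HarmonicAt.comp_conj {f : ℂ → E} {z : ℂ} (hf : HarmonicAt f ((starRingEnd ℂ) z)) :
    HarmonicAt (fun w => f ((starRingEnd ℂ) w)) z := by
  have hc : ContDiffAt ℝ 2 (fun w : ℂ => (starRingEnd ℂ) w) z := Complex.conjCLE.contDiff.contDiffAt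
  refine harmonicAt_of_forall_inner (ContDiffAt.comp z hf.1 hc) ?_
  filter_upwards [hc.continuousAt.eventually hf.eventually] with w hw v
  obtain ⟨Φ, h1, h2⟩ := exists_analyticAt_re_eventuallyEq (hw.comp_CLM (innerSL ℝ v))
  have h3 : AnalyticAt ℂ (fun y => (starRingEnd ℂ) (Φ ((starRingEnd ℂ) y))) w := by
    rw [Complex.analyticAt_iff_eventually_differentiableAt]
    have := Complex.analyticAt_iff_eventually_differentiableAt.1 h1
    filter_upwards [Complex.continuous_conj.continuousAt.eventually this] with y hy
    simpa [Function.comp_def] using hy.conj_conj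
  have h4 : (fun y => (inner ℝ v (f ((starRingEnd ℂ) y)) : ℝ)) =ᶠ[𝓝 w]
      fun y => (Φ ((starRingEnd ℂ) y)).re :=
    h2.comp_tendsto Complex.continuous_conj.continuousAt
  rw [harmonicAt_congr_nhds h4]
  simpa using h3.harmonicAt_re

/-- Harmonicity is invariant under precomposition with conformal maps of plane domains. -/
theorem InnerProductSpace.HarmonicAt.comp_conformalAt {f : ℂ → E} {k : ℂ → ℂ} {z : ℂ} (hf : HarmonicAt f (k z))
    (hk : ContDiffAt ℝ 1 k z) (hc : ∀ᶠ w in 𝓝 z, ConformalAt k w) :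
    HarmonicAt (fun w => f (k w)) z := by
  rcases analyticAt_or_analyticAt_conj_of_conformalAt hk hc with h | h
  · exact HarmonicAt.comp_analyticAt hf h
  · have h1 : HarmonicAt (fun w => f ((starRingEnd ℂ) w)) ((starRingEnd ℂ) (k z)) :=
      HarmonicAt.comp_conj (by simpa using hf)
    simpa using HarmonicAt.comp_analyticAt (k := fun w => (starRingEnd ℂ) (k w)) h1 h

/-- A real linear map from the plane is weakly conformal if it is zero or a multiple of a linear
isometry, which is expressed here by means of the images of `1` and `i`. -/
def IsWeaklyConformal (L : ℂ →L[ℝ] E) : Prop :=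
  ‖L 1‖ = ‖L Complex.I‖ ∧ inner ℝ (L 1) (L Complex.I) = 0

theorem IsWeaklyConformal.inner_map_map {L : ℂ →L[ℝ] E} (hL : IsWeaklyConformal L) (v w : ℂ) :
    inner ℝ (L v) (L w) = ‖L 1‖ ^ 2 * inner ℝ v w := by
  have h : ∀ v : ℂ, L v = v.re • L 1 + v.im • L Complex.I := fun v => by
    conv_lhs => rw [show v = v.re • (1 : ℂ) + v.im • Complex.I by simp]
    rw [map_add, L.map_smul, L.map_smul]
  rw [h v, h w, Complex.inner]
  simp only [inner_add_left, inner_add_right, real_inner_smul_left, real_inner_smul_right, hL.2,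
    real_inner_comm (L 1) (L Complex.I), real_inner_self_eq_norm_sq, ← hL.1]
  simp
  ring

theorem isWeaklyConformal_of_inner {L : ℂ →L[ℝ] E} {c : ℝ}
    (h : ∀ v w : ℂ, inner ℝ (L v) (L w) = c * inner ℝ v w) : IsWeaklyConformal L := by
  refine ⟨?_, by rw [h]; simp [Complex.inner]⟩
  have h1 := h 1 1
  have h2 := h Complex.I Complex.I
  rw [real_inner_self_eq_norm_sq] at h1 h2
  simp only [real_inner_self_eq_norm_sq] at h1 h2
  rw [← sq_eq_sq₀ (norm_nonneg _) (norm_nonneg _), h1, h2]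
  simp

theorem IsConformalMap.isWeaklyConformal {L : ℂ →L[ℝ] E} (h : IsConformalMap L) :
    IsWeaklyConformal L := by
  obtain ⟨c, -, hc⟩ := (isConformalMap_iff L).1 h
  exact isWeaklyConformal_of_inner hc

theorem IsWeaklyConformal.comp {L : ℂ →L[ℝ] E} (hL : IsWeaklyConformal L) {K : ℂ →L[ℝ] ℂ}
    (hK : IsWeaklyConformal K) : IsWeaklyConformal (L.comp K) :=
  isWeaklyConformal_of_inner (c := ‖L 1‖ ^ 2 * ‖K 1‖ ^ 2) fun v w => by
    rw [ContinuousLinearMap.comp_apply, ContinuousLinearMap.comp_apply, hL.inner_map_map,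
      hK.inner_map_map, mul_assoc]

theorem IsWeaklyConformal.exists_eq_smul_isometry {L : ℂ →L[ℝ] E} (hL : IsWeaklyConformal L)
    (h0 : L ≠ 0) : ∃ l : ℝ, 0 < l ∧ ∃ J : ℂ →ₗᵢ[ℝ] E, L = l • J.toContinuousLinearMap := by
  have hl : 0 < ‖L 1‖ := by
    rw [norm_pos_iff]
    intro h
    apply h0
    ext v
    have := hL.inner_map_map v v
    rw [h] at this
    simpa using this
  refine ⟨‖L 1‖, hl, (‖L 1‖⁻¹ • (L : ℂ →ₗ[ℝ] E)).isometryOfInner fun v w => ?_, ?_⟩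
  · simp only [LinearMap.smul_apply, ContinuousLinearMap.coe_coe, real_inner_smul_left,
      real_inner_smul_right, hL.inner_map_map]
    field_simp
  · ext v
    simp [hl.ne']

/-! ### The Schwarz–Pick lemma on the disc -/

/-- Every point of the unit ball lies in the affine disc through it which is parallel to the image
of a given isometry of the plane. -/
theorem exists_affineDisc_coordinates {x : E} (hx : ‖x‖ < 1) (J : ℂ →ₗᵢ[ℝ] E) :
    ∃ (p : E) (R : ℝ) (b : ℂ), (∀ w, inner ℝ p (J w) = 0) ∧ 0 < R ∧ ‖p‖ ^ 2 + R ^ 2 = 1 ∧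
      ‖b‖ < 1 ∧ x = p + R • J b := by
  set c : ℂ := ⟨inner ℝ (J 1) x, inner ℝ (J Complex.I) x⟩ with hc
  have hcw : ∀ w, inner ℝ x (J w) = inner ℝ c w := fun w => by
    rw [linearIsometry_complex_apply J w, inner_add_right, inner_smul_right, inner_smul_right,
      Complex.inner]
    simp [hc, real_inner_comm]
  have hperp : ∀ w, inner ℝ (x - J c) (J w) = 0 := fun w => by
    rw [inner_sub_left, hcw, J.inner_map_map, sub_self]
  have hsq : ‖x‖ ^ 2 = ‖x - J c‖ ^ 2 + ‖c‖ ^ 2 := by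
    have := norm_sq_add_smul_isometry hperp 1 c
    simpa using this
  have hx2 : ‖x‖ ^ 2 < 1 := by nlinarith [norm_nonneg x]
  have hp : 0 < 1 - ‖x - J c‖ ^ 2 := by nlinarith [norm_nonneg c]
  have hR : 0 < √(1 - ‖x - J c‖ ^ 2) := Real.sqrt_pos.2 hp
  have hR2 : √(1 - ‖x - J c‖ ^ 2) ^ 2 = 1 - ‖x - J c‖ ^ 2 := Real.sq_sqrt hp.le
  refine ⟨x - J c, √(1 - ‖x - J c‖ ^ 2), (√(1 - ‖x - J c‖ ^ 2))⁻¹ • c, hperp, hR, ?_, ?_, ?_⟩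
  · rw [hR2]; ring
  · rw [norm_smul, norm_inv, Real.norm_of_nonneg hR.le, inv_mul_lt_one₀ hR]
    nlinarith [norm_nonneg c]
  · rw [J.map_smul, smul_inv_smul₀ hR.ne']; simp

/-- The Schwarz–Pick lemma for harmonic maps of the disc into the unit ball which are conformal at
a point `z₀`, with its rigidity part. -/
theorem exists_affineDisc_comparison {F : ℂ → E} (hF : HarmonicOnNhd F (ball 0 1))
    (hF1 : ∀ z ∈ ball (0 : ℂ) 1, ‖F z‖ < 1) {z₀ : ℂ} (hz₀ : ‖z₀‖ < 1)
    (hc : IsWeaklyConformal (fderiv ℝ F z₀)) (h0 : fderiv ℝ F z₀ ≠ 0) :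
    ∃ (p : E) (R : ℝ) (J : ℂ →ₗᵢ[ℝ] E) (b : ℂ) (l : ℝ), (∀ w, inner ℝ p (J w) = 0) ∧ 0 < R ∧
      ‖p‖ ^ 2 + R ^ 2 = 1 ∧ ‖b‖ < 1 ∧ F z₀ = p + R • J b ∧ 0 < l ∧
      fderiv ℝ F z₀ = l • J.toContinuousLinearMap ∧
      l * (1 - ‖z₀‖ ^ 2) ≤ R * (1 - ‖b‖ ^ 2) ∧
      (l * (1 - ‖z₀‖ ^ 2) = R * (1 - ‖b‖ ^ 2) →
        ∀ z ∈ ball (0 : ℂ) 1, F z = p + R • J (discAut b (-z₀) z)) := by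
  obtain ⟨l, hl, J, hJ⟩ := hc.exists_eq_smul_isometry h0
  have hz₀' : z₀ ∈ ball (0 : ℂ) 1 := by simpa using hz₀
  obtain ⟨p, R, b, hpJ, hR, hpR, hb, hx⟩ := exists_affineDisc_coordinates (hF1 z₀ hz₀') J
  have hmem : ∀ z ∈ ball (0 : ℂ) 1, discShift z₀ z ∈ ball (0 : ℂ) 1 := fun z hz => by
    simpa using norm_discShift_lt_one hz₀ (by simpa using hz)
  set G : ℂ → E := fun z => F (discShift z₀ z) with hG
  have hGh : HarmonicOnNhd G (ball 0 1) := fun z hz =>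
    HarmonicAt.comp_analyticAt (hF _ (hmem z hz))
      (analyticAt_discShift hz₀ (by simpa using (mem_ball_zero_iff.1 hz).le))
  have hG1 : ∀ z ∈ ball (0 : ℂ) 1, ‖G z‖ < 1 := fun z hz => hF1 _ (hmem z hz)
  have hG0 : G 0 = p + R • J b := by rw [hG]; simp only [discShift_zero_right]; exact hx
  have hFd : DifferentiableAt ℝ F (discShift z₀ 0) := by
    rw [discShift_zero_right]; exact (hF z₀ hz₀').1.differentiableAt two_ne_zero
  have hdG : fderiv ℝ G 0 = (l * (1 - ‖z₀‖ ^ 2)) • J.toContinuousLinearMap := by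
    have h1 := hFd.hasFDerivAt.comp 0
      ((hasDerivAt_discShift_zero z₀).hasFDerivAt.restrictScalars ℝ)
    have h2 := h1.fderiv
    rw [discShift_zero_right, hJ] at h2
    refine h2.trans ?_
    ext v
    have : v * ((1 - ‖z₀‖ ^ 2 : ℝ) : ℂ) = (1 - ‖z₀‖ ^ 2) • v := by
      rw [Complex.real_smul, mul_comm]
    simp only [ContinuousLinearMap.comp_apply, smul_apply, LinearIsometry.coe_toContinuousLinearMap,
      ContinuousLinearMap.coe_restrictScalars', ContinuousLinearMap.toSpanSingleton_apply,
      smul_eq_mul, this, J.map_smul, smul_smul]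
  refine ⟨p, R, J, b, l, hpJ, hR, hpR, hb, hx, hl, hJ,
    differential_scale_le_at_zero hGh hG1 hpJ hR hpR hb hG0 hdG, fun heq z hz => ?_⟩
  have hz' : ‖z‖ < 1 := by simpa using hz
  have h1 := eq_discParam_of_scale_eq_at_zero hGh hG1 hpJ hpR hb hG0 hdG heq
    (norm_discShift_lt_one (b := -z₀) (by simpa using hz₀) hz')
  rw [discAut, ← h1, hG]
  have h2 := discShift_neg_discShift (b := -z₀) (z := z) (by simpa using hz₀) hz'.le
  rw [neg_neg] at h2
  simp only [h2]

/-- The Cayley–Klein metric of the unit ball of an inner product space. On `EuclideanSpace ℝ (Fin n)`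
it is `cayleyKlein` by definition. -/
def kleinNorm (x v : E) : ℝ :=
  √(‖v‖ ^ 2 / (1 - ‖x‖ ^ 2) + (inner ℝ x v) ^ 2 / (1 - ‖x‖ ^ 2) ^ 2)

theorem kleinNorm_le_on_affineDisc {p : E} {R l : ℝ} {J : ℂ →ₗᵢ[ℝ] E} {b : ℂ}
    (hpJ : ∀ w, inner ℝ p (J w) = 0) (hR : 0 < R) (hpR : ‖p‖ ^ 2 + R ^ 2 = 1) (hb : ‖b‖ < 1)
    (hl : 0 < l) (η : ℂ) :
    kleinNorm (p + R • J b) (l • J η) ≤ l * ‖η‖ / (R * (1 - ‖b‖ ^ 2)) := by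
  have hd : 0 < 1 - ‖b‖ ^ 2 := by nlinarith [norm_nonneg b]
  have hD : 1 - ‖p + R • J b‖ ^ 2 = R ^ 2 * (1 - ‖b‖ ^ 2) := by
    rw [norm_sq_add_smul_isometry hpJ]; linarith
  have hin : inner ℝ (p + R • J b) (l • J η) = R * l * inner ℝ b η := by
    rw [inner_add_left, inner_smul_right, hpJ, real_inner_smul_left, real_inner_smul_right,
      J.inner_map_map]
    ring
  have hcs : (inner ℝ b η : ℝ) ^ 2 ≤ ‖b‖ ^ 2 * ‖η‖ ^ 2 := by
    rw [← mul_pow, ← sq_abs]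
    exact pow_le_pow_left₀ (abs_nonneg _) (abs_real_inner_le_norm b η) 2
  rw [kleinNorm, hD, hin]
  refine Real.sqrt_le_iff.2 ⟨by positivity, ?_⟩
  rw [norm_smul, J.norm_map, Real.norm_of_nonneg hl.le]
  have : (l * ‖η‖ / (R * (1 - ‖b‖ ^ 2))) ^ 2 - ((l * ‖η‖) ^ 2 / (R ^ 2 * (1 - ‖b‖ ^ 2)) +
      (R * l * inner ℝ b η) ^ 2 / (R ^ 2 * (1 - ‖b‖ ^ 2)) ^ 2) =
      l ^ 2 / (R ^ 2 * (1 - ‖b‖ ^ 2) ^ 2) * (‖b‖ ^ 2 * ‖η‖ ^ 2 - (inner ℝ b η) ^ 2) := by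
    field_simp
    ring
  have h2 : 0 ≤ l ^ 2 / (R ^ 2 * (1 - ‖b‖ ^ 2) ^ 2) * (‖b‖ ^ 2 * ‖η‖ ^ 2 - (inner ℝ b η) ^ 2) :=
    mul_nonneg (by positivity) (by linarith)
  linarith

theorem kleinNorm_nonneg (x v : E) : 0 ≤ kleinNorm x v := Real.sqrt_nonneg _

theorem kleinNorm_zero_right (x : E) : kleinNorm x 0 = 0 := by simp [kleinNorm]

theorem discPoincareMetric_pos {z η : ℂ} (hz : ‖z‖ < 1) (hη : η ≠ 0) :
    0 < discPoincareMetric z η :=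
  div_pos (norm_pos_iff.2 hη) (by nlinarith [norm_nonneg z])

theorem kleinNorm_fderiv_le {F : ℂ → E} (hF : HarmonicOnNhd F (ball 0 1))
    (hF1 : ∀ z ∈ ball (0 : ℂ) 1, ‖F z‖ < 1) {z₀ : ℂ} (hz₀ : ‖z₀‖ < 1)
    (hc : IsWeaklyConformal (fderiv ℝ F z₀)) (η : ℂ) :
    kleinNorm (F z₀) (fderiv ℝ F z₀ η) ≤ discPoincareMetric z₀ η := by
  have ht : 0 < 1 - ‖z₀‖ ^ 2 := by nlinarith [norm_nonneg z₀]
  by_cases h0 : fderiv ℝ F z₀ = 0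
  · rw [h0, zero_apply, kleinNorm_zero_right]
    exact div_nonneg (norm_nonneg _) ht.le
  obtain ⟨p, R, J, b, l, hpJ, hR, hpR, hb, hx, hl, hJ, hle, -⟩ :=
    exists_affineDisc_comparison hF hF1 hz₀ hc h0
  have hd : 0 < 1 - ‖b‖ ^ 2 := by nlinarith [norm_nonneg b]
  rw [hx, hJ]
  refine (kleinNorm_le_on_affineDisc hpJ hR hpR hb hl η).trans ?_
  rw [discPoincareMetric, div_le_div_iff₀ (by positivity) ht]
  nlinarith [mul_le_mul_of_nonneg_right hle (norm_nonneg η)]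

/-- If equality holds at one nonzero vector, the map is a conformal parametrization of an affine
disc. -/
theorem eq_affineDisc_of_kleinNorm_fderiv_eq {F : ℂ → E} (hF : HarmonicOnNhd F (ball 0 1))
    (hF1 : ∀ z ∈ ball (0 : ℂ) 1, ‖F z‖ < 1) {z₀ : ℂ} (hz₀ : ‖z₀‖ < 1)
    (hc : IsWeaklyConformal (fderiv ℝ F z₀)) {η : ℂ} (hη : η ≠ 0)
    (heq : kleinNorm (F z₀) (fderiv ℝ F z₀ η) = discPoincareMetric z₀ η) :
    ∃ (p : E) (R : ℝ) (J : ℂ →ₗᵢ[ℝ] E) (b : ℂ), (∀ w, inner ℝ p (J w) = 0) ∧ 0 < R ∧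
      ‖p‖ ^ 2 + R ^ 2 = 1 ∧ ‖b‖ < 1 ∧
      ∀ z ∈ ball (0 : ℂ) 1, F z = p + R • J (discAut b (-z₀) z) := by
  have ht : 0 < 1 - ‖z₀‖ ^ 2 := by nlinarith [norm_nonneg z₀]
  by_cases h0 : fderiv ℝ F z₀ = 0
  · rw [h0, zero_apply, kleinNorm_zero_right] at heq
    exact absurd heq (discPoincareMetric_pos hz₀ hη).ne
  obtain ⟨p, R, J, b, l, hpJ, hR, hpR, hb, hx, hl, hJ, hle, hrig⟩ :=
    exists_affineDisc_comparison hF hF1 hz₀ hc h0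
  refine ⟨p, R, J, b, hpJ, hR, hpR, hb, hrig (hle.antisymm ?_)⟩
  have hd : 0 < 1 - ‖b‖ ^ 2 := by nlinarith [norm_nonneg b]
  have h1 := kleinNorm_le_on_affineDisc hpJ hR hpR hb hl η
  have h2 : fderiv ℝ F z₀ η = l • J η := by rw [hJ]; rfl
  rw [← hx, ← h2, heq, discPoincareMetric, div_le_div_iff₀ ht (by positivity)] at h1
  have hn := norm_pos_iff.2 hη
  refine le_of_mul_le_mul_left ?_ hn
  linarith

/-- The case of maps into the disc itself, in its usual form. -/
theorem discPoincareMetric_fderiv_le {F : ℂ → ℂ} (hF : HarmonicOnNhd F (ball 0 1))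
    (hF1 : ∀ z ∈ ball (0 : ℂ) 1, ‖F z‖ < 1) {z₀ : ℂ} (hz₀ : ‖z₀‖ < 1)
    (hc : IsWeaklyConformal (fderiv ℝ F z₀)) (η : ℂ) :
    discPoincareMetric (F z₀) (fderiv ℝ F z₀ η) ≤ discPoincareMetric z₀ η := by
  have ht : 0 < 1 - ‖z₀‖ ^ 2 := by nlinarith [norm_nonneg z₀]
  by_cases h0 : fderiv ℝ F z₀ = 0
  · rw [h0, zero_apply, discPoincareMetric, norm_zero, zero_div]
    exact div_nonneg (norm_nonneg _) ht.le
  obtain ⟨p, R, J, b, l, hpJ, hR, hpR, hb, hx, hl, hJ, hle, -⟩ :=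
    exists_affineDisc_comparison hF hF1 hz₀ hc h0
  obtain ⟨w, hw⟩ := (J.toLinearIsometryEquiv rfl).surjective p
  have hw' : J w = p := hw
  have hp : p = 0 := by
    have := hpJ w
    rw [hw'] at this
    exact inner_self_eq_zero.1 this
  have hR1 : R = 1 := by
    rw [hp, norm_zero] at hpR
    nlinarith
  have hd : 0 < 1 - ‖b‖ ^ 2 := by nlinarith [norm_nonneg b]
  have h2 : fderiv ℝ F z₀ η = l • J η := by rw [hJ]; rfl
  rw [h2, hx, hp, hR1, one_smul, zero_add, discPoincareMetric, discPoincareMetric, norm_smul,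
    J.norm_map, J.norm_map, Real.norm_of_nonneg hl.le, div_le_div_iff₀ hd ht]
  rw [hR1] at hle
  nlinarith [mul_le_mul_of_nonneg_right hle (norm_nonneg η)]

theorem continuousAt_kleinNorm {X : Type*} [TopologicalSpace X] {u v : X → E} {x : X}
    (hu : ContinuousAt u x) (hv : ContinuousAt v x) (h1 : ‖u x‖ < 1) :
    ContinuousAt (fun y => kleinNorm (u y) (v y)) x := by
  have h : 1 - ‖u x‖ ^ 2 ≠ 0 := by nlinarith [norm_nonneg (u x)]
  have h2 : ContinuousAt (fun y => (inner ℝ (u y) (v y) : ℝ)) x := hu.inner hv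
  unfold kleinNorm
  exact (((hv.norm.pow 2).div (continuousAt_const.sub (hu.norm.pow 2)) h).add
    ((h2.pow 2).div ((continuousAt_const.sub (hu.norm.pow 2)).pow 2) (pow_ne_zero 2 h))).sqrt

theorem kleinNorm_smul (x v : E) (c : ℝ) : kleinNorm x (c • v) = |c| * kleinNorm x v := by
  rw [kleinNorm, kleinNorm, ← Real.sqrt_sq_eq_abs, ← Real.sqrt_mul (sq_nonneg c), norm_smul,
    inner_smul_right, mul_pow, mul_pow, Real.norm_eq_abs, sq_abs]
  congr 1
  ring

/-- If the Schwarz–Pick inequality is strict everywhere, it is uniformly strict on compact sets. -/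
theorem exists_uniform_gap {F : ℂ → E} (hF : HarmonicOnNhd F (ball 0 1))
    (hF1 : ∀ z ∈ ball (0 : ℂ) 1, ‖F z‖ < 1)
    (hlt : ∀ z ∈ ball (0 : ℂ) 1, ∀ η : ℂ, η ≠ 0 →
      kleinNorm (F z) (fderiv ℝ F z η) < discPoincareMetric z η)
    {K : Set ℂ} (hK : IsCompact K) (hK1 : K ⊆ ball 0 1) :
    ∃ ε : ℝ, 0 < ε ∧ ∀ z ∈ K, ∀ η : ℂ,
      kleinNorm (F z) (fderiv ℝ F z η) + ε * ‖η‖ ≤ discPoincareMetric z η := by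
  have hcont : ContinuousOn (fun x : ℂ × ℂ =>
      discPoincareMetric x.1 x.2 - kleinNorm (F x.1) (fderiv ℝ F x.1 x.2))
      (K ×ˢ sphere (0 : ℂ) 1) := by
    rintro ⟨z, η⟩ ⟨hz, -⟩
    have hz1 := hK1 hz
    have hz' : 1 - ‖z‖ ^ 2 ≠ 0 := by
      have : ‖z‖ < 1 := by simpa using hz1
      nlinarith [norm_nonneg z]
    have hFz := (hF z hz1).1
    have h1 : ContinuousAt (fun x : ℂ × ℂ => F x.1) (z, η) :=
      ContinuousAt.comp (f := Prod.fst) (x := (z, η)) hFz.continuousAt continuousAt_fst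
    have h2 : ContinuousAt (fun x : ℂ × ℂ => fderiv ℝ F x.1 x.2) (z, η) :=
      (ContinuousAt.comp (f := Prod.fst) (x := (z, η))
        (hFz.fderiv_right (m := 0) (by norm_num)).continuousAt continuousAt_fst).clm_apply
        continuousAt_snd
    refine ContinuousAt.continuousWithinAt (ContinuousAt.sub ?_
      (continuousAt_kleinNorm h1 h2 (hF1 z hz1)))
    unfold discPoincareMetric
    exact continuousAt_snd.norm.div (continuousAt_const.sub (continuousAt_fst.norm.pow 2)) hz'
  obtain ⟨ε, hε, h⟩ := (hK.prod (isCompact_sphere (0 : ℂ) 1)).exists_forall_le' hcont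
    (a := 0) (fun x hx => by
      have hne : x.2 ≠ 0 := ne_of_mem_sphere hx.2 one_ne_zero
      have := hlt x.1 (hK1 hx.1) x.2 hne
      simpa using this)
  refine ⟨ε, hε, fun z hz η => ?_⟩
  by_cases hη : η = 0
  · simp [hη, kleinNorm_zero_right, discPoincareMetric]
  have hn : 0 < ‖η‖ := norm_pos_iff.2 hη
  have h1 := h (z, ‖η‖⁻¹ • η) ⟨hz, by simp [hn.ne']⟩
  simp only [map_smul, kleinNorm_smul, discPoincareMetric, norm_smul, norm_inv, norm_norm,
    abs_inv, abs_norm, inv_mul_cancel₀ hn.ne'] at h1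
  have h2 := mul_le_mul_of_nonneg_left h1 hn.le
  rw [mul_sub, ← mul_assoc, mul_inv_cancel₀ hn.ne', one_mul, mul_one_div] at h2
  rw [discPoincareMetric]
  linarith

end InnerProductSpace

/-! ### Coverings by the disc and the Poincaré metric -/

theorem exists_smooth_localInverse {k : ℂ → ℂ} {y : ℂ} (hk : ContDiffAt ℝ ∞ k y)
    (hc : ConformalAt k y) :
    ∃ s : ℂ → ℂ, ContDiffAt ℝ ∞ s (k y) ∧ s (k y) = y ∧ (∀ᶠ w in 𝓝 y, s (k w) = w) ∧
      ∀ᶠ v in 𝓝 (k y), k (s v) = v := by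
  have hinj : Function.Injective (fderiv ℝ k y) :=
    (conformalAt_iff_isConformalMap_fderiv.1 hc).injective
  set L : ℂ ≃L[ℝ] ℂ := (LinearEquiv.ofInjectiveEndo (fderiv ℝ k y : ℂ →ₗ[ℝ] ℂ)
    hinj).toContinuousLinearEquiv with hL
  have hfd : HasFDerivAt k (L : ℂ →L[ℝ] ℂ) y := by
    have : (L : ℂ →L[ℝ] ℂ) = fderiv ℝ k y := by ext v; rfl
    rw [this]; exact hc.differentiableAt.hasFDerivAt
  have hn : (∞ : WithTop ℕ∞) ≠ 0 := by simp
  set Θ := hk.toOpenPartialHomeomorph k hfd hn with hΘ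
  have h1 : y ∈ Θ.source := hk.mem_toOpenPartialHomeomorph_source hfd hn
  have h2 : k y ∈ Θ.target := hk.image_mem_toOpenPartialHomeomorph_target hfd hn
  refine ⟨hk.localInverse hfd hn, hk.to_localInverse hfd hn, hk.localInverse_apply_image hfd hn,
    ?_, ?_⟩
  · filter_upwards [Θ.open_source.mem_nhds h1] with w hw using Θ.left_inv hw
  · filter_upwards [Θ.open_target.mem_nhds h2] with v hv using Θ.right_inv hv

/-- A continuous local lift of a smooth conformal map through a smooth conformal map is smooth and
conformal. -/
theorem contDiffAt_and_conformalAt_of_lift {k q m : ℂ → ℂ} {z : ℂ} (hq : ContinuousAt q z)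
    (hk : ContDiffAt ℝ ∞ k (q z)) (hkc : ConformalAt k (q z))
    (hm : ContDiffAt ℝ ∞ m z) (hmc : ConformalAt m z) (h : ∀ᶠ w in 𝓝 z, k (q w) = m w) :
    ContDiffAt ℝ ∞ q z ∧ ConformalAt q z := by
  obtain ⟨s, hs, -, hs1, -⟩ := exists_smooth_localInverse hk hkc
  have hqs : q =ᶠ[𝓝 z] fun w => s (m w) := by
    filter_upwards [h, hq.eventually hs1] with w hw hw1
    rw [← hw, hw1]
  have hkm : k (q z) = m z := h.self_of_nhds
  have hsm : ContDiffAt ℝ ∞ q z := by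
    rw [hkm] at hs
    exact (hs.comp z hm).congr_of_eventuallyEq hqs
  refine ⟨hsm, ?_⟩
  have hqd : DifferentiableAt ℝ q z := hsm.differentiableAt (by simp)
  have hcomp : fderiv ℝ m z = (fderiv ℝ k (q z)).comp (fderiv ℝ q z) := by
    rw [← fderiv_comp z hkc.differentiableAt hqd]
    exact (Filter.EventuallyEq.fderiv_eq (f₁ := k ∘ q) h).symm
  rw [conformalAt_iff_isConformalMap_fderiv, isConformalMap_iff] at hkc hmc ⊢
  obtain ⟨c₁, hc₁, h₁⟩ := hkc
  obtain ⟨c₂, hc₂, h₂⟩ := hmc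
  refine ⟨c₂ / c₁, by positivity, fun u v => ?_⟩
  have h3 := h₂ u v
  rw [hcomp, ContinuousLinearMap.comp_apply, ContinuousLinearMap.comp_apply, h₁] at h3
  rw [div_mul_eq_mul_div, eq_div_iff hc₁.ne', ← h3, mul_comm]

section Surface

variable {M : Type*} [TopologicalSpace M] [ChartedSpace ℂ M]
  {E : Type*} [NormedAddCommGroup E] [InnerProductSpace ℝ E]

namespace IsConformalDiscCovering

variable {h : ℂ → M}

theorem contMDiffAt (hh : IsConformalDiscCovering h) {z : ℂ} (hz : ‖z‖ < 1) :
    ContMDiffAt 𝓘(ℝ, ℂ) 𝓘(ℝ, ℂ) ∞ h z :=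
  hh.contMDiffOn.contMDiffAt (isOpen_ball.mem_nhds (by simpa using hz))

theorem continuousAt (hh : IsConformalDiscCovering h) {z : ℂ} (hz : ‖z‖ < 1) :
    ContinuousAt h z :=
  (hh.contMDiffAt hz).continuousAt

theorem exists_mem_ball (hh : IsConformalDiscCovering h) (p : M) : ∃ z, ‖z‖ < 1 ∧ h z = p := by
  obtain ⟨z, hz, hzp⟩ := hh.surjOn (mem_univ p)
  exact ⟨z, by simpa using hz, hzp⟩

theorem isOpen_image (hh : IsConformalDiscCovering h) {U : Set ℂ}
    (hU : IsOpen U) (hU1 : U ⊆ ball 0 1) : IsOpen (h '' U) := by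
  have h1 := hh.isCoveringMap.isLocalHomeomorph.isOpenMap _ (hU.preimage continuous_subtype_val)
  convert h1 using 1
  ext p
  constructor
  · rintro ⟨w, hw, rfl⟩
    exact ⟨⟨w, hU1 hw⟩, hw, rfl⟩
  · rintro ⟨w, hw, rfl⟩
    exact ⟨w, hw, rfl⟩

/-- A conformal map lifts to a conformal map of the disc. -/
theorem isWeaklyConformal_comp (hh : IsConformalDiscCovering h) {f : M → E}
    (hf : IsConformalMapOnSurface f) {z : ℂ} (hz : ‖z‖ < 1) :
    IsWeaklyConformal (fderiv ℝ (f ∘ h) z) := by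
  set e := chartAt ℂ (h z) with he
  have hs : h z ∈ e.source := mem_chart_source ℂ (h z)
  have hea : e ∈ atlas ℂ M := chart_mem_atlas ℂ (h z)
  have hc := hh.conformalAt z (by simpa using hz) e hea hs
  obtain ⟨hd, h1, h2⟩ := hf e hea _ (e.map_source hs)
  have heq : f ∘ h =ᶠ[𝓝 z] (f ∘ e.symm) ∘ (e ∘ h) := by
    filter_upwards [(hh.continuousAt hz).eventually (e.open_source.eventually_mem hs)] with w hw
    simp [e.left_inv hw]
  rw [heq.fderiv_eq, fderiv_comp z (by exact hd) hc.differentiableAt]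
  exact IsWeaklyConformal.comp ⟨h1, h2⟩
    (conformalAt_iff_isConformalMap_fderiv.1 hc).isWeaklyConformal

variable [IsManifold 𝓘(ℝ, ℂ) ∞ M]

theorem contDiffAt_chart_comp (hh : IsConformalDiscCovering h) {z : ℂ} (hz : ‖z‖ < 1)
    {e : OpenPartialHomeomorph M ℂ} (he : e ∈ atlas ℂ M) (hze : h z ∈ e.source) :
    ContDiffAt ℝ ∞ (e ∘ h) z := by
  rw [← contMDiffAt_iff_contDiffAt]
  exact (contMDiffAt_of_mem_maximalAtlas (IsManifold.subset_maximalAtlas he) hze).comp z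
    (hh.contMDiffAt hz)

theorem mfderiv_injective (hh : IsConformalDiscCovering h) {z : ℂ} (hz : ‖z‖ < 1) :
    Function.Injective (mfderiv 𝓘(ℝ, ℂ) 𝓘(ℝ, ℂ) h z) := by
  have : IsManifold 𝓘(ℝ, ℂ) 1 M := IsManifold.of_le (n := ∞) (by simp)
  set e := chartAt ℂ (h z) with he
  have hs : h z ∈ e.source := mem_chart_source ℂ (h z)
  have hd : MDifferentiableAt 𝓘(ℝ, ℂ) 𝓘(ℝ, ℂ) h z := (hh.contMDiffAt hz).mdifferentiableAt (by simp)
  have hed : MDifferentiableAt 𝓘(ℝ, ℂ) 𝓘(ℝ, ℂ) e (h z) :=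
    mdifferentiableAt_atlas (chart_mem_atlas ℂ (h z)) hs
  have hcomp := mfderiv_comp z hed hd
  have hinj : Function.Injective (mfderiv 𝓘(ℝ, ℂ) 𝓘(ℝ, ℂ) (e ∘ h) z) := by
    rw [mfderiv_eq_fderiv]
    exact (conformalAt_iff_isConformalMap_fderiv.1
      (hh.conformalAt z (by simpa using hz) e (chart_mem_atlas ℂ (h z)) hs)).injective
  rw [hcomp] at hinj
  exact Function.Injective.of_comp (f := mfderiv 𝓘(ℝ, ℂ) 𝓘(ℝ, ℂ) e (h z)) hinj

theorem mfderiv_surjective (hh : IsConformalDiscCovering h) {z : ℂ} (hz : ‖z‖ < 1) :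
    Function.Surjective (mfderiv 𝓘(ℝ, ℂ) 𝓘(ℝ, ℂ) h z) := by
  have key : ∀ L : ℂ →L[ℝ] ℂ, Function.Injective L → Function.Surjective L := fun L hL =>
    (LinearMap.injective_iff_surjective (f := L.toLinearMap)).1 hL
  exact key (mfderiv 𝓘(ℝ, ℂ) 𝓘(ℝ, ℂ) h z) (hh.mfderiv_injective hz)

/-- A harmonic map lifts to a harmonic map of the disc. -/
theorem harmonicOnNhd_comp (hh : IsConformalDiscCovering h) {f : M → E} (hf : IsHarmonicMap f) :
    HarmonicOnNhd (f ∘ h) (ball 0 1) := by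
  intro z hz
  have hz' : ‖z‖ < 1 := by simpa using hz
  set e := chartAt ℂ (h z) with he
  have hs : h z ∈ e.source := mem_chart_source ℂ (h z)
  have hea : e ∈ atlas ℂ M := chart_mem_atlas ℂ (h z)
  have hev : ∀ᶠ w in 𝓝 z, w ∈ ball (0 : ℂ) 1 ∧ h w ∈ e.source :=
    (isOpen_ball.eventually_mem hz).and
      ((hh.continuousAt hz').eventually (e.open_source.eventually_mem hs))
  have h1 : HarmonicAt (fun w => (f ∘ e.symm) ((e ∘ h) w)) z := by
    refine HarmonicAt.comp_conformalAt (hf e hea _ (e.map_source hs))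
      ((hh.contDiffAt_chart_comp hz' hea hs).of_le (by simp)) ?_
    filter_upwards [hev] with w hw using hh.conformalAt w hw.1 e hea hw.2
  refine (harmonicAt_congr_nhds ?_).1 h1
  filter_upwards [hev] with w hw
  simp [e.left_inv hw.2]

end IsConformalDiscCovering

variable [IsManifold 𝓘(ℝ, ℂ) ∞ M]

theorem IsHarmonicMap.contMDiff {f : M → E} (hf : IsHarmonicMap f) :
    ContMDiff 𝓘(ℝ, ℂ) 𝓘(ℝ, E) 1 f := by
  intro p
  set e := chartAt ℂ p with he
  have hs : p ∈ e.source := mem_chart_source ℂ p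
  have hea : e ∈ atlas ℂ M := chart_mem_atlas ℂ p
  have : IsManifold 𝓘(ℝ, ℂ) 1 M := IsManifold.of_le (n := ∞) (by simp)
  have h1 : ContMDiffAt 𝓘(ℝ, ℂ) 𝓘(ℝ, E) 1 (f ∘ e.symm) (e p) :=
    ((hf e hea _ (e.map_source hs)).1.of_le (by norm_num)).contMDiffAt
  have h2 : ContMDiffAt 𝓘(ℝ, ℂ) 𝓘(ℝ, ℂ) 1 e p :=
    contMDiffAt_of_mem_maximalAtlas (IsManifold.subset_maximalAtlas hea) hs
  refine (h1.comp p h2).congr_of_eventuallyEq ?_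
  filter_upwards [e.open_source.mem_nhds hs] with w hw
  simp [e.left_inv hw]

theorem IsConformalDiscCovering.mfderiv_mfderiv {h : ℂ → M} (hh : IsConformalDiscCovering h)
    {f : M → E} (hf : IsHarmonicMap f) {z : ℂ} (hz : ‖z‖ < 1) (η : ℂ) :
    mfderiv 𝓘(ℝ, ℂ) 𝓘(ℝ, E) f (h z) (mfderiv 𝓘(ℝ, ℂ) 𝓘(ℝ, ℂ) h z η) = fderiv ℝ (f ∘ h) z η := by
  rw [← mfderiv_eq_fderiv, mfderiv_comp z (hf.contMDiff.contMDiffAt.mdifferentiableAt (by simp))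
    ((hh.contMDiffAt hz).mdifferentiableAt (by simp))]
  rfl

/-- The Poincaré length does not depend on the covering: coverings lift through each other, and
lifts are conformal self-maps of the disc, so the Schwarz–Pick lemma applies to them. -/
theorem IsConformalDiscCovering.discPoincareMetric_le {h₁ h₂ : ℂ → M}
    (hh₁ : IsConformalDiscCovering h₁) (hh₂ : IsConformalDiscCovering h₂) {z₁ z₂ η₁ η₂ : ℂ}
    (hz₁ : ‖z₁‖ < 1) (hz₂ : ‖z₂‖ < 1)
    (heq : tangentMap 𝓘(ℝ, ℂ) 𝓘(ℝ, ℂ) h₁ ⟨z₁, η₁⟩ = tangentMap 𝓘(ℝ, ℂ) 𝓘(ℝ, ℂ) h₂ ⟨z₂, η₂⟩) :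
    discPoincareMetric z₂ η₂ ≤ discPoincareMetric z₁ η₁ := by
  classical
  have hpt : h₁ z₁ = h₂ z₂ := congrArg (fun v => v.1) heq
  have hz₁' : z₁ ∈ ball (0 : ℂ) 1 := by simpa using hz₁
  have hz₂' : z₂ ∈ ball (0 : ℂ) 1 := by simpa using hz₂
  have : ContractibleSpace (ball (0 : ℂ) 1) := (convex_ball 0 1).contractibleSpace ⟨0, by simp⟩
  have : LocallyPathConnectedSpace (ball (0 : ℂ) 1) := isOpen_ball.locallyPathConnectedSpace
  obtain ⟨ψ, ⟨hψ1, hψ2⟩, -⟩ := hh₂.isCoveringMap.existsUnique_continuousMap_lifts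
    ⟨fun z : ball (0 : ℂ) 1 => h₁ z, hh₁.isCoveringMap.continuous⟩ ⟨z₁, hz₁'⟩ ⟨z₂, hz₂'⟩ hpt.symm
  -- the lift of `h₁` through `h₂`, with a junk value outside the disc
  set q : ℂ → ℂ := fun z => if hz : z ∈ ball (0 : ℂ) 1 then (ψ ⟨z, hz⟩ : ℂ) else 0 with hq
  have hqv : ∀ (z : ℂ) (hz : z ∈ ball (0 : ℂ) 1), q z = ψ ⟨z, hz⟩ := fun z hz => dif_pos hz
  have hq1 : ∀ z ∈ ball (0 : ℂ) 1, ‖q z‖ < 1 := fun z hz => by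
    rw [hqv z hz]; exact mem_ball_zero_iff.1 (ψ ⟨z, hz⟩).2
  have hqz : q z₁ = z₂ := by rw [hqv z₁ hz₁', hψ1]
  have hqh : ∀ z ∈ ball (0 : ℂ) 1, h₂ (q z) = h₁ z := fun z hz => by
    rw [hqv z hz]; exact congrFun hψ2 ⟨z, hz⟩
  have hqc : ∀ z ∈ ball (0 : ℂ) 1, ContinuousAt q z := by
    intro z hz
    have : ContinuousOn q (ball 0 1) := by
      rw [continuousOn_iff_continuous_domRestrict]
      have h2 : (ball (0 : ℂ) 1).domRestrict q = fun z => (ψ z : ℂ) := by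
        ext z; exact hqv z z.2
      rw [h2]
      exact continuous_subtype_val.comp ψ.continuous
    exact this.continuousAt (isOpen_ball.mem_nhds hz)
  have hsm : ∀ z ∈ ball (0 : ℂ) 1, ContDiffAt ℝ ∞ q z ∧ ConformalAt q z := by
    intro z hz
    set e := chartAt ℂ (h₁ z) with he
    have hs : h₁ z ∈ e.source := mem_chart_source ℂ (h₁ z)
    have hs2 : h₂ (q z) ∈ e.source := by rw [hqh z hz]; exact hs
    have hea : e ∈ atlas ℂ M := chart_mem_atlas ℂ (h₁ z)
    refine contDiffAt_and_conformalAt_of_lift (k := e ∘ h₂) (m := e ∘ h₁) (hqc z hz)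
      (hh₂.contDiffAt_chart_comp (hq1 z hz) hea hs2)
      (hh₂.conformalAt _ (by simpa using hq1 z hz) e hea hs2)
      (hh₁.contDiffAt_chart_comp (by simpa using hz) hea hs) (hh₁.conformalAt z hz e hea hs) ?_
    filter_upwards [isOpen_ball.mem_nhds hz] with w hw
    simp [hqh w hw]
  have hharm : HarmonicOnNhd q (ball 0 1) := fun z hz =>
    HarmonicAt.comp_conformalAt (f := fun w => w) analyticAt_id.harmonicAt
      ((hsm z hz).1.of_le (by simp))
      (by filter_upwards [isOpen_ball.mem_nhds hz] with w hw using (hsm w hw).2)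
  have hder : fderiv ℝ q z₁ η₁ = η₂ := by
    apply hh₂.mfderiv_injective hz₂
    have h2 := ((hh₂.contMDiffAt (hq1 z₁ hz₁')).mdifferentiableAt (by simp)).hasMFDerivAt.comp z₁
      ((hsm z₁ hz₁').1.contMDiffAt.mdifferentiableAt (by simp)).hasMFDerivAt
    have h1 := (h2.congr_of_eventuallyEq (f₁ := h₁) (by
      filter_upwards [isOpen_ball.mem_nhds hz₁'] with w hw using (hqh w hw).symm)).mfderiv
    subst hqz
    have h3 : mfderiv 𝓘(ℝ, ℂ) 𝓘(ℝ, ℂ) h₁ z₁ η₁ = mfderiv 𝓘(ℝ, ℂ) 𝓘(ℝ, ℂ) h₂ (q z₁) η₂ := by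
      have := heq
      simp only [tangentMap, Bundle.TotalSpace.mk.injEq] at this
      exact eq_of_heq this.2
    rw [← h3, h1, mfderiv_eq_fderiv]
    rfl
  have hfin := discPoincareMetric_fderiv_le hharm hq1 hz₁
    (conformalAt_iff_isConformalMap_fderiv.1 (hsm z₁ hz₁').2).isWeaklyConformal η₁
  rwa [hqz, hder] at hfin

/-- Conformal coverings by the disc are local isometries for the Poincaré metric: the set whose
infimum defines the metric is a singleton. -/
theorem IsConformalDiscCovering.poincareMetric_eq {h : ℂ → M} (hh : IsConformalDiscCovering h)
    {z : ℂ} (hz : ‖z‖ < 1) (η : ℂ) :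
    poincareMetric (h z) (mfderiv 𝓘(ℝ, ℂ) 𝓘(ℝ, ℂ) h z η) = discPoincareMetric z η := by
  have hset : {r : ℝ | ∃ (h' : ℂ → M) (z' : ℂ) (η' : TangentSpace 𝓘(ℝ, ℂ) z'),
      IsConformalDiscCovering h' ∧ z' ∈ ball (0 : ℂ) 1 ∧
      tangentMap 𝓘(ℝ, ℂ) 𝓘(ℝ, ℂ) h' ⟨z', η'⟩ =
        ⟨h z, mfderiv 𝓘(ℝ, ℂ) 𝓘(ℝ, ℂ) h z η⟩ ∧ r = discPoincareMetric z' η'} =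
      {discPoincareMetric z η} := by
    ext r
    simp only [mem_ofPred_eq, mem_singleton_iff]
    constructor
    · rintro ⟨h', z', η', hh', hz', heq, rfl⟩
      have hz'' : ‖z'‖ < 1 := by simpa using hz'
      exact le_antisymm
        (hh.discPoincareMetric_le hh' hz hz'' heq.symm)
        (hh'.discPoincareMetric_le hh hz'' hz heq)
    · rintro rfl
      exact ⟨h, z, η, hh, by simpa using hz, rfl, rfl⟩
  rw [poincareMetric, hset, csInf_singleton]

end Surface

/-! ### Comparison of metrics and distances -/

/-- Points of the ball have finite distance, as the segment between them has finite length. -/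
theorem cayleyKleinEDist_lt_top {n : ℕ} {x y : EuclideanSpace ℝ (Fin n)} (hx : ‖x‖ < 1)
    (hy : ‖y‖ < 1) : cayleyKleinEDist x y < ⊤ := by
  set γ : ℝ → EuclideanSpace ℝ (Fin n) := fun t => x + t • (y - x) with hγ
  have hd : ∀ t, HasDerivAt γ (y - x) t := fun t =>
    (((hasDerivAt_id t).smul_const (y - x)).const_add x).congr_deriv (one_smul ℝ _)
  have hsm : ContDiff ℝ 1 γ := by fun_prop
  have hm : MapsTo γ (Icc 0 1) (ball 0 1) := fun t ht =>
    (convex_ball 0 1).add_smul_sub_mem (by simpa using hx) (by simpa using hy) ht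
  have hm' : ∀ t ∈ Icc (0 : ℝ) 1, ‖γ t‖ < 1 := fun t ht => by simpa using hm ht
  refine lt_of_le_of_lt (iInf_le_of_le γ <| iInf_le_of_le
    (contMDiffOn_iff_contDiffOn.2 hsm.contDiffOn) <| iInf_le_of_le hm <|
    iInf_le_of_le (by simp [hγ]) <| iInf_le_of_le (by simp [hγ]) le_rfl) ?_
  have hcont : ContinuousOn (fun t => kleinNorm (γ t) (y - x)) (Icc 0 1) := fun t ht =>
    (continuousAt_kleinNorm hsm.continuous.continuousAt continuousAt_const
      (hm' t ht)).continuousWithinAt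
  refine lt_of_le_of_lt (le_of_eq ?_) (hcont.integrableOn_Icc (μ := volume)).lintegral_lt_top
  refine setLIntegral_congr_fun measurableSet_Icc fun t ht => ?_
  have hu : UniqueDiffWithinAt ℝ (Icc (0 : ℝ) 1) t := uniqueDiffOn_Icc zero_lt_one t ht
  have : mfderivWithin 𝓘(ℝ, ℝ) 𝓘(ℝ, EuclideanSpace ℝ (Fin n)) γ (Icc 0 1) t (1 : ℝ) = y - x := by
    rw [mfderivWithin_eq_fderivWithin]
    exact (hd t).hasDerivWithinAt.derivWithin hu
  simp only [this]
  rfl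

section Surface

variable {M : Type*} [TopologicalSpace M] [ChartedSpace ℂ M] [IsManifold 𝓘(ℝ, ℂ) ∞ M] {n : ℕ}
  {f : M → EuclideanSpace ℝ (Fin n)} {h : ℂ → M}

/-- The lengths of a tangent vector and of its image, computed in the universal covering. -/
theorem IsConformalDiscCovering.metrics_eq (hh : IsConformalDiscCovering h) (hf : IsHarmonicMap f)
    {p : M} {z : ℂ} (hz : ‖z‖ < 1) (hp : h z = p) (ξ : TangentSpace 𝓘(ℝ, ℂ) p) (η : ℂ)
    (hξ : (mfderiv 𝓘(ℝ, ℂ) 𝓘(ℝ, ℂ) h z η : ℂ) = (ξ : ℂ)) :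
    poincareMetric p ξ = discPoincareMetric z η ∧
    cayleyKlein (f p) (mfderiv 𝓘(ℝ, ℂ) 𝓘(ℝ, EuclideanSpace ℝ (Fin n)) f p ξ) =
      kleinNorm ((f ∘ h) z) (fderiv ℝ (f ∘ h) z η) := by
  subst hp
  obtain rfl : mfderiv 𝓘(ℝ, ℂ) 𝓘(ℝ, ℂ) h z η = ξ := hξ
  refine ⟨hh.poincareMetric_eq hz η, ?_⟩
  rw [hh.mfderiv_mfderiv hf hz]
  rfl

theorem IsConformalDiscCovering.exists_tangent (hh : IsConformalDiscCovering h) (p : M)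
    (ξ : TangentSpace 𝓘(ℝ, ℂ) p) : ∃ (z η : ℂ), ‖z‖ < 1 ∧ h z = p ∧
      (mfderiv 𝓘(ℝ, ℂ) 𝓘(ℝ, ℂ) h z η : ℂ) = (ξ : ℂ) := by
  obtain ⟨z, hz, rfl⟩ := hh.exists_mem_ball p
  obtain ⟨η, hη⟩ := hh.mfderiv_surjective hz ξ
  exact ⟨z, η, hz, rfl, hη⟩

theorem cayleyKlein_mfderiv_le (hh : IsConformalDiscCovering h) (hf : IsHarmonicMap f)
    (hball : ∀ p, f p ∈ ball (0 : EuclideanSpace ℝ (Fin n)) 1)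
    (hconf : IsConformalMapOnSurface f) (p : M) (ξ : TangentSpace 𝓘(ℝ, ℂ) p) :
    cayleyKlein (f p) (mfderiv 𝓘(ℝ, ℂ) 𝓘(ℝ, EuclideanSpace ℝ (Fin n)) f p ξ)
      ≤ poincareMetric p ξ := by
  obtain ⟨z, η, hz, hp, hη⟩ := hh.exists_tangent p ξ
  obtain ⟨h1, h2⟩ := hh.metrics_eq hf hz hp ξ η hη
  rw [h1, h2]
  exact kleinNorm_fderiv_le (hh.harmonicOnNhd_comp hf)
    (fun z _ => by simpa using hball (h z)) hz (hh.isWeaklyConformal_comp hconf hz) η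

theorem mfderivWithin_comp_path (hf : IsHarmonicMap f) {γ : ℝ → M}
    (hγ : ContMDiffOn 𝓘(ℝ, ℝ) 𝓘(ℝ, ℂ) 1 γ (Icc 0 1)) {t : ℝ} (ht : t ∈ Icc (0 : ℝ) 1) :
    mfderivWithin 𝓘(ℝ, ℝ) 𝓘(ℝ, EuclideanSpace ℝ (Fin n)) (f ∘ γ) (Icc 0 1) t (1 : ℝ) =
      mfderiv 𝓘(ℝ, ℂ) 𝓘(ℝ, EuclideanSpace ℝ (Fin n)) f (γ t)
        (mfderivWithin 𝓘(ℝ, ℝ) 𝓘(ℝ, ℂ) γ (Icc 0 1) t (1 : ℝ)) := by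
  have hu : UniqueMDiffWithinAt 𝓘(ℝ, ℝ) (Icc (0 : ℝ) 1) t :=
    uniqueMDiffWithinAt_iff_uniqueDiffWithinAt.2 (uniqueDiffOn_Icc zero_lt_one t ht)
  rw [mfderiv_comp_mfderivWithin t (hf.contMDiff.contMDiffAt.mdifferentiableAt (by simp))
    ((hγ t ht).mdifferentiableWithinAt (by simp)) hu]
  rfl

theorem cayleyKleinEDist_le_length (hf : IsHarmonicMap f)
    (hball : ∀ p, f p ∈ ball (0 : EuclideanSpace ℝ (Fin n)) 1) {γ : ℝ → M}
    (hγ : ContMDiffOn 𝓘(ℝ, ℝ) 𝓘(ℝ, ℂ) 1 γ (Icc 0 1)) :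
    cayleyKleinEDist (f (γ 0)) (f (γ 1)) ≤ ∫⁻ t in Icc (0 : ℝ) 1, ENNReal.ofReal
      (cayleyKlein (f (γ t)) (mfderiv 𝓘(ℝ, ℂ) 𝓘(ℝ, EuclideanSpace ℝ (Fin n)) f (γ t)
        (mfderivWithin 𝓘(ℝ, ℝ) 𝓘(ℝ, ℂ) γ (Icc 0 1) t (1 : ℝ)))) := by
  refine iInf_le_of_le (f ∘ γ) <| iInf_le_of_le (hf.contMDiff.comp_contMDiffOn hγ) <|
    iInf_le_of_le (fun t _ => hball (γ t)) <| iInf_le_of_le rfl <| iInf_le_of_le rfl <|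
    le_of_eq <| setLIntegral_congr_fun measurableSet_Icc fun t ht => ?_
  simp only [mfderivWithin_comp_path hf hγ ht]
  rfl

theorem cayleyKleinEDist_le_poincareEDist (hh : IsConformalDiscCovering h) (hf : IsHarmonicMap f)
    (hball : ∀ p, f p ∈ ball (0 : EuclideanSpace ℝ (Fin n)) 1)
    (hconf : IsConformalMapOnSurface f) (p q : M) :
    cayleyKleinEDist (f p) (f q) ≤ poincareEDist p q := by
  refine le_iInf fun γ => le_iInf fun hγ => le_iInf fun _ => le_iInf fun h0 => le_iInf fun h1 => ?_
  subst h0 h1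
  exact (cayleyKleinEDist_le_length hf hball hγ).trans (lintegral_mono fun t =>
    ENNReal.ofReal_le_ofReal (cayleyKlein_mfderiv_le hh hf hball hconf _ _))

/-! ### Equality of distances -/

/-- Near a point of the disc, a conformal covering has a smooth inverse, on a small closed disc
whose image avoids a given other point. -/
theorem IsConformalDiscCovering.exists_local_section [T2Space M] (hh : IsConformalDiscCovering h)
    {z₀ : ℂ} (hz₀ : ‖z₀‖ < 1) {q : M} (hq : h z₀ ≠ q) :
    ∃ (δ : ℝ) (σ : M → ℂ), 0 < δ ∧ ∀ w ∈ closedBall z₀ δ, ‖w‖ < 1 ∧ h w ≠ q ∧ σ (h w) = w ∧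
      ContMDiffAt 𝓘(ℝ, ℂ) 𝓘(ℝ, ℂ) 1 σ (h w) := by
  set e := chartAt ℂ (h z₀) with he
  have hs : h z₀ ∈ e.source := mem_chart_source ℂ (h z₀)
  have hea : e ∈ atlas ℂ M := chart_mem_atlas ℂ (h z₀)
  have hz₀' : z₀ ∈ ball (0 : ℂ) 1 := by simpa using hz₀
  have hk := hh.contDiffAt_chart_comp hz₀ hea hs
  obtain ⟨s, hs1, -, hs2, -⟩ := exists_smooth_localInverse hk (hh.conformalAt z₀ hz₀' e hea hs)
  have hs3 : ∀ᶠ v in 𝓝 ((e ∘ h) z₀), ContDiffAt ℝ 1 s v :=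
    (hs1.of_le (m := 1) (by simp)).eventually (by simp)
  have hc := hh.continuousAt hz₀
  have hev : ∀ᶠ w in 𝓝 z₀, ‖w‖ < 1 ∧ h w ≠ q ∧ s (e (h w)) = w ∧
      ContMDiffAt 𝓘(ℝ, ℂ) 𝓘(ℝ, ℂ) 1 (s ∘ e) (h w) := by
    filter_upwards [isOpen_ball.mem_nhds hz₀', hc.eventually_ne hq, hs2,
      hk.continuousAt.eventually hs3, hc.eventually (e.open_source.eventually_mem hs)]
      with w h1 h2 h3 h4 h5
    have : IsManifold 𝓘(ℝ, ℂ) 1 M := IsManifold.of_le (n := ∞) (by simp)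
    exact ⟨by simpa using h1, h2, h3, (ContDiffAt.contMDiffAt h4).comp (h w)
      (contMDiffAt_of_mem_maximalAtlas (IsManifold.subset_maximalAtlas hea) h5)⟩
  obtain ⟨δ, hδ, H⟩ := nhds_basis_closedBall.eventually_iff.1 hev
  exact ⟨δ, s ∘ e, hδ, fun w hw => H hw⟩

/-- If the Schwarz–Pick inequality is strict everywhere, every path from `p` to `q ≠ p` loses a
fixed amount of length: it has to cross a small disc around `p`, in which the inequality is
uniformly strict. -/
theorem exists_length_gap [T2Space M] (hh : IsConformalDiscCovering h) (hf : IsHarmonicMap f)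
    (hball : ∀ p, f p ∈ ball (0 : EuclideanSpace ℝ (Fin n)) 1)
    (hconf : IsConformalMapOnSurface f)
    (hlt : ∀ z ∈ ball (0 : ℂ) 1, ∀ η : ℂ, η ≠ 0 →
      kleinNorm ((f ∘ h) z) (fderiv ℝ (f ∘ h) z η) < discPoincareMetric z η)
    {p q : M} (hpq : p ≠ q) :
    ∃ c : ℝ, 0 < c ∧ cayleyKleinEDist (f p) (f q) + ENNReal.ofReal c ≤ poincareEDist p q := by
  obtain ⟨z₀, hz₀, rfl⟩ := hh.exists_mem_ball p
  obtain ⟨δ, s, hδ, hs⟩ := hh.exists_local_section hz₀ hpq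
  have hKb : closedBall z₀ δ ⊆ ball 0 1 := fun w hw => by simpa using (hs w hw).1
  obtain ⟨ε, hε, hgap⟩ := exists_uniform_gap (hh.harmonicOnNhd_comp hf)
    (fun z _ => by simpa using hball (h z)) hlt (isCompact_closedBall z₀ δ) hKb
  refine ⟨ε * δ, by positivity, ?_⟩
  refine le_iInf fun γ => le_iInf fun hγ => le_iInf fun _ => le_iInf fun h0 => le_iInf fun h1 => ?_
  have hγc : ContinuousOn γ (Icc 0 1) := hγ.continuousOn
  set V : Set M := h '' ball z₀ δ with hV
  have hVo : IsOpen V := hh.isOpen_image isOpen_ball (ball_subset_closedBall.trans hKb)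
  have hKc : IsClosed (h '' closedBall z₀ δ) :=
    ((isCompact_closedBall z₀ δ).image_of_continuousOn fun w hw =>
      (hh.continuousAt (hs w hw).1).continuousWithinAt).isClosed
  -- the first time at which the path leaves the open disc around its starting point
  set A : Set ℝ := Icc 0 1 ∩ γ ⁻¹' Vᶜ with hA
  have hAc : IsClosed A := hγc.preimage_isClosed_of_isClosed isClosed_Icc hVo.isClosed_compl
  have hA1 : (1 : ℝ) ∈ A := by
    refine ⟨by simp, ?_⟩
    rintro ⟨w, hw, hwq⟩
    exact (hs w (ball_subset_closedBall hw)).2.1 (hwq.trans h1)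
  have hAb : BddBelow A := ⟨0, fun t ht => ht.1.1⟩
  set T : ℝ := sInf A with hT
  have hTA : T ∈ A := hAc.csInf_mem ⟨1, hA1⟩ hAb
  have hT1 : T ≤ 1 := hTA.1.2
  have hT0 : 0 < T := by
    refine hTA.1.1.lt_of_ne fun h => hTA.2 ?_
    rw [← h, h0]
    exact ⟨z₀, mem_ball_self hδ, rfl⟩
  have hsub : Icc 0 T ⊆ Icc (0 : ℝ) 1 := Icc_subset_Icc_right hT1
  have hVt : ∀ t ∈ Ico 0 T, γ t ∈ V := fun t ht => by
    by_contra hc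
    exact notMem_of_lt_csInf ht.2 hAb ⟨⟨ht.1, ht.2.le.trans hT1⟩, hc⟩
  have hKt : ∀ t ∈ Icc 0 T, γ t ∈ h '' closedBall z₀ δ := by
    intro t ht
    have h2 : t ∈ closure (Ico 0 T) := by rwa [closure_Ico hT0.ne]
    have h3 : ContinuousWithinAt γ (Ico 0 T) t :=
      (hγc t (hsub ht)).mono (Ico_subset_Icc_self.trans hsub)
    have h4 := h3.mem_closure_image h2
    refine hKc.closure_subset_iff.2 ?_ h4
    rintro _ ⟨u, hu, rfl⟩
    exact image_mono ball_subset_closedBall (hVt u hu)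
  set σ : ℝ → ℂ := s ∘ γ with hσ
  have hσt : ∀ t ∈ Icc 0 T, σ t ∈ closedBall z₀ δ ∧ h (σ t) = γ t := by
    intro t ht
    obtain ⟨w, hw, hwt⟩ := hKt t ht
    have : σ t = w := by rw [hσ, Function.comp_apply, ← hwt, (hs w hw).2.2.1]
    rw [this]
    exact ⟨hw, hwt⟩
  have hσ0 : σ 0 = z₀ := by
    rw [hσ, Function.comp_apply, h0, (hs z₀ (mem_closedBall_self hδ.le)).2.2.1]
  have hσT : δ ≤ ‖σ T - z₀‖ := by
    by_contra hc
    obtain ⟨h2, h3⟩ := hσt T ⟨hT0.le, le_rfl⟩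
    exact hTA.2 ⟨σ T, by simpa [dist_eq_norm] using hc, h3⟩
  have hσs : ContDiffOn ℝ 1 σ (Icc 0 T) := by
    rw [← contMDiffOn_iff_contDiffOn]
    intro t ht
    obtain ⟨h2, h3⟩ := hσt t ht
    have h4 := (hs _ h2).2.2.2
    rw [h3] at h4
    exact h4.comp_contMDiffWithinAt t ((hγ t (hsub ht)).mono hsub)
  have hlen : ENNReal.ofReal (ε * δ) ≤
      ∫⁻ t in Icc (0 : ℝ) 1, (Ioo 0 T).indicator (fun t => ENNReal.ofReal (ε * ‖deriv σ t‖)) t := by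
    rw [setLIntegral_indicator measurableSet_Ioo,
      inter_eq_left.2 (Ioo_subset_Icc_self.trans hsub)]
    have h2 := enorm_sub_le_lintegral_derivWithin_Icc_of_contDiffOn_Icc hσs hT0.le
    rw [← restrict_Ioo_eq_restrict_Icc, hσ0] at h2
    calc ENNReal.ofReal (ε * δ) ≤ ENNReal.ofReal ε * ‖σ T - z₀‖ₑ := by
          rw [ENNReal.ofReal_mul hε.le, ← ofReal_norm]
          gcongr
      _ ≤ ENNReal.ofReal ε * ∫⁻ t in Ioo 0 T, ‖derivWithin σ (Icc 0 T) t‖ₑ := by gcongr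
      _ = ∫⁻ t in Ioo 0 T, ENNReal.ofReal ε * ‖derivWithin σ (Icc 0 T) t‖ₑ :=
          (lintegral_const_mul' _ _ ENNReal.ofReal_ne_top).symm
      _ = _ := by
          refine setLIntegral_congr_fun measurableSet_Ioo fun t ht => ?_
          simp only [derivWithin_of_mem_nhds (Icc_mem_nhds ht.1 ht.2), ENNReal.ofReal_mul hε.le,
            ofReal_norm]
  have hmeas : Measurable
      ((Ioo 0 T).indicator (fun t => ENNReal.ofReal (ε * ‖deriv σ t‖))) :=
    (((measurable_deriv σ).norm.const_mul ε).ennreal_ofReal).indicator measurableSet_Ioo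
  have hCK := cayleyKleinEDist_le_length hf hball hγ
  rw [h0, h1] at hCK
  refine (add_le_add hCK hlen).trans ?_
  rw [← lintegral_add_right _ hmeas]
  refine lintegral_mono fun t => ?_
  by_cases ht : t ∈ Ioo 0 T
  · rw [indicator_of_mem ht]
    obtain ⟨h2, h3⟩ := hσt t (Ioo_subset_Icc_self ht)
    have hz : ‖σ t‖ < 1 := (hs _ h2).1
    have hnhds : Icc 0 T ∈ 𝓝 t := Icc_mem_nhds ht.1 ht.2
    have hσd : MDifferentiableAt 𝓘(ℝ, ℝ) 𝓘(ℝ, ℂ) σ t :=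
      ((hσs.contDiffAt hnhds).differentiableAt one_ne_zero).mdifferentiableAt
    have h4 := ((hh.contMDiffAt hz).mdifferentiableAt (by simp)).hasMFDerivAt.comp t
      hσd.hasMFDerivAt
    have h5 := (h4.congr_of_eventuallyEq (f₁ := γ) (by
      filter_upwards [hnhds] with u hu using (hσt u hu).2.symm)).mfderiv
    have h6 : mfderivWithin 𝓘(ℝ, ℝ) 𝓘(ℝ, ℂ) γ (Icc 0 1) t = mfderiv 𝓘(ℝ, ℝ) 𝓘(ℝ, ℂ) γ t :=
      mfderivWithin_of_mem_nhds (mem_of_superset hnhds hsub)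
    obtain ⟨h7, h8⟩ := hh.metrics_eq hf hz h3
      (mfderivWithin 𝓘(ℝ, ℝ) 𝓘(ℝ, ℂ) γ (Icc 0 1) t (1 : ℝ)) (deriv σ t) (by
        rw [h6, h5, mfderiv_eq_fderiv]
        rfl)
    have h9 : ENNReal.ofReal (kleinNorm ((f ∘ h) (σ t)) (fderiv ℝ (f ∘ h) (σ t) (deriv σ t))) +
        ENNReal.ofReal (ε * ‖deriv σ t‖) ≤
        ENNReal.ofReal (discPoincareMetric (σ t) (deriv σ t)) := by
      rw [← ENNReal.ofReal_add (kleinNorm_nonneg _ _) (by positivity)]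
      exact ENNReal.ofReal_le_ofReal (hgap _ h2 _)
    exact (add_le_add (ENNReal.ofReal_le_ofReal h8.le) le_rfl).trans
      (h9.trans (ENNReal.ofReal_le_ofReal h7.ge))
  · rw [indicator_of_notMem ht, add_zero]
    exact ENNReal.ofReal_le_ofReal (cayleyKlein_mfderiv_le hh hf hball hconf _ _)

/-- Equality of distances forces equality of the metrics at some nonzero tangent vector. -/
theorem exists_metric_eq_of_edist_eq [T2Space M] (hh : IsConformalDiscCovering h)
    (hf : IsHarmonicMap f)
    (hball : ∀ p, f p ∈ ball (0 : EuclideanSpace ℝ (Fin n)) 1)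
    (hconf : IsConformalMapOnSurface f) {p q : M} (hpq : p ≠ q)
    (heq : cayleyKleinEDist (f p) (f q) = poincareEDist p q) :
    ∃ z ∈ ball (0 : ℂ) 1, ∃ η : ℂ, η ≠ 0 ∧
      kleinNorm ((f ∘ h) z) (fderiv ℝ (f ∘ h) z η) = discPoincareMetric z η := by
  by_contra! hne
  obtain ⟨c, hc, hle⟩ := exists_length_gap hh hf hball hconf (fun z hz η hη =>
    lt_of_le_of_ne (kleinNorm_fderiv_le (hh.harmonicOnNhd_comp hf)
      (fun z _ => by simpa using hball (h z)) (by simpa using hz)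
      (hh.isWeaklyConformal_comp hconf (by simpa using hz)) η) (hne z hz η hη)) hpq
  have hfin : cayleyKleinEDist (f p) (f q) < ⊤ :=
    cayleyKleinEDist_lt_top (by simpa using hball p) (by simpa using hball q)
  rw [← heq] at hle
  have := ENNReal.lt_add_right hfin.ne (ENNReal.ofReal_pos.2 hc).ne'
  exact this.not_ge hle

end Surface

/-! ### Conformal diffeomorphisms onto affine discs -/

theorem isAffineDisc_of_isometry {n : ℕ} {p : EuclideanSpace ℝ (Fin n)} (hp : ‖p‖ < 1)
    (J : ℂ →ₗᵢ[ℝ] EuclideanSpace ℝ (Fin n)) :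
    IsAffineDisc ((AffineSubspace.mk' p (LinearMap.range J.toLinearMap) :
      Set (EuclideanSpace ℝ (Fin n))) ∩ ball 0 1) := by
  refine ⟨⟨p, AffineSubspace.self_mem_mk' _ _, by simpa using hp⟩, _, ?_, rfl⟩
  rw [AffineSubspace.direction_mk', LinearMap.finrank_range_of_inj J.injective,
    Complex.finrank_real_complex]

section Surface

variable {M : Type*} [TopologicalSpace M] [ChartedSpace ℂ M] [IsManifold 𝓘(ℝ, ℂ) ∞ M] {h : ℂ → M}

/-- An injective conformal covering by the disc is a conformal diffeomorphism. -/
theorem IsConformalDiscCovering.isConformalDiffeoOnto_inverse (hh : IsConformalDiscCovering h)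
    {φ : M → ℂ} (hφ1 : ∀ p, ‖φ p‖ < 1) (hφ : ∀ p, h (φ p) = p)
    (hφ' : ∀ z, ‖z‖ < 1 → φ (h z) = z) : IsConformalDiffeoOnto φ (ball 0 1) := by
  have hcont : Continuous φ := by
    refine continuous_def.2 fun U hU => ?_
    have : φ ⁻¹' U = h '' (U ∩ ball 0 1) := by
      ext p
      constructor
      · exact fun hp => ⟨φ p, ⟨hp, by simpa using hφ1 p⟩, hφ p⟩
      · rintro ⟨z, ⟨hz, hz1⟩, rfl⟩
        rwa [mem_preimage, hφ' z (by simpa using hz1)]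
    rw [this]
    exact hh.isOpen_image (hU.inter isOpen_ball) inter_subset_right
  have key : ∀ e ∈ atlas ℂ M, ∀ v ∈ e.target,
      ContDiffAt ℝ ∞ (φ ∘ e.symm) v ∧ ConformalAt (φ ∘ e.symm) v := by
    intro e he v hv
    have hs : h ((φ ∘ e.symm) v) ∈ e.source := by
      rw [Function.comp_apply, hφ]; exact e.map_target hv
    have hz : ‖(φ ∘ e.symm) v‖ < 1 := hφ1 _
    refine contDiffAt_and_conformalAt_of_lift (k := e ∘ h) (m := id)
      (hcont.continuousAt.comp (e.symm.continuousAt hv))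
      (hh.contDiffAt_chart_comp hz he hs) (hh.conformalAt _ (by simpa using hz) e he hs)
      contDiffAt_id (conformalAt_id v) ?_
    filter_upwards [e.open_target.mem_nhds hv] with w hw
    simp [hφ, e.right_inv hw]
  refine ⟨fun p => ?_, ?_, ⟨h, hh.contMDiffOn, hφ⟩, fun e he v hv => (key e he v hv).2⟩
  · set e := chartAt ℂ p with he
    have hs : p ∈ e.source := mem_chart_source ℂ p
    have hea : e ∈ atlas ℂ M := chart_mem_atlas ℂ p
    refine ((ContDiffAt.contMDiffAt (key e hea _ (e.map_source hs)).1).comp p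
      (contMDiffAt_of_mem_maximalAtlas (IsManifold.subset_maximalAtlas hea)
        hs)).congr_of_eventuallyEq ?_
    filter_upwards [e.open_source.mem_nhds hs] with w hw
    simp [e.left_inv hw]
  · ext z
    constructor
    · rintro ⟨p, rfl⟩; simpa using hφ1 p
    · intro hz; exact ⟨h z, hφ' z (by simpa using hz)⟩

/-- If a map `f` on `M` lifts to a conformal parametrization of an affine disc, then the covering
is injective, and `f` is a conformal diffeomorphism onto the affine disc. -/
theorem IsConformalDiscCovering.conformalDiffeos_of_lift_eq {n : ℕ}
    (hh : IsConformalDiscCovering h) {f : M → EuclideanSpace ℝ (Fin n)}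
    {p : EuclideanSpace ℝ (Fin n)} {R : ℝ} {J : ℂ →ₗᵢ[ℝ] EuclideanSpace ℝ (Fin n)} {a b : ℂ}
    (hpJ : ∀ w, inner ℝ p (J w) = 0) (hR : 0 < R) (hpR : ‖p‖ ^ 2 + R ^ 2 = 1)
    (hb : ‖b‖ < 1) (ha : ‖a‖ < 1)
    (hf : ∀ z ∈ ball (0 : ℂ) 1, f (h z) = p + R • J (discAut b a z)) :
    (∃ φ : M → ℂ, IsConformalDiffeoOnto φ (ball 0 1)) ∧
      ∃ S : Set (EuclideanSpace ℝ (Fin n)), IsAffineDisc S ∧ IsConformalDiffeoOnto f S := by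
  have hb' : ‖-b‖ < 1 := by rwa [norm_neg]
  have ha' : ‖-a‖ < 1 := by rwa [norm_neg]
  set P : EuclideanSpace ℝ (Fin n) → ℂ := fun x =>
    R⁻¹ • ContinuousLinearMap.adjoint J.toContinuousLinearMap (x - p) with hP
  have hPs : ContDiff ℝ ∞ P := by fun_prop
  have hPw : ∀ w, P (p + R • J w) = w := by
    intro w
    have : ContinuousLinearMap.adjoint J.toContinuousLinearMap (J w) = w :=
      ext_inner_right ℝ fun u => by
        rw [ContinuousLinearMap.adjoint_inner_left]
        exact J.inner_map_map w u
    simp [hP, this, hR.ne']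
  -- the inverse of the parametrization, extended smoothly to all of space
  set ν : EuclideanSpace ℝ (Fin n) → ℂ := fun x => discAut (-a) (-b) (P x) with hν
  have hνz : ∀ z, ‖z‖ < 1 → ν (p + R • J (discAut b a z)) = z := fun z hz => by
    rw [hν]; simp only [hPw]; exact discAut_neg_discAut hb ha hz
  choose φ hφ1 hφ using hh.exists_mem_ball
  have hfφ : ∀ q, f q = p + R • J (discAut b a (φ q)) := fun q => by
    rw [← hf (φ q) (by simpa using hφ1 q), hφ]
  have hφ' : ∀ z, ‖z‖ < 1 → φ (h z) = z := fun z hz => by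
    rw [← hνz _ (hφ1 (h z)), ← hfφ, hf z (by simpa using hz), hνz z hz]
  have hφd := hh.isConformalDiffeoOnto_inverse hφ1 hφ hφ'
  refine ⟨⟨φ, hφd⟩, _, isAffineDisc_of_isometry (by nlinarith [norm_nonneg p]) J, ?_⟩
  set S : Set (EuclideanSpace ℝ (Fin n)) :=
    (AffineSubspace.mk' p (LinearMap.range J.toLinearMap) : Set _) ∩ ball 0 1 with hS
  have hrange : range f = S := by
    ext x
    constructor
    · rintro ⟨q, rfl⟩
      rw [hfφ q]
      refine ⟨?_, ?_⟩
      · rw [SetLike.mem_coe, AffineSubspace.mem_mk']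
        refine ⟨R • discAut b a (φ q), ?_⟩
        rw [vsub_eq_sub, add_sub_cancel_left]
        exact J.map_smul R _
      · have h1 := norm_discAut_lt_one hb ha (hφ1 q)
        have h2 := norm_sq_add_smul_isometry hpJ R (discAut b a (φ q))
        rw [mem_ball_zero_iff]
        have h3 : ‖discAut b a (φ q)‖ ^ 2 < 1 := by nlinarith [norm_nonneg (discAut b a (φ q))]
        have h4 : R ^ 2 * ‖discAut b a (φ q)‖ ^ 2 < R ^ 2 * 1 :=
          mul_lt_mul_of_pos_left h3 (by positivity)
        nlinarith [norm_nonneg (p + R • J (discAut b a (φ q)))]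
    · rintro ⟨hx, hx1⟩
      rw [SetLike.mem_coe, AffineSubspace.mem_mk'] at hx
      obtain ⟨w, hw⟩ := hx
      have hw' : J w = x - p := hw
      have hxw : x = p + R • J (R⁻¹ • w) := by
        rw [J.map_smul, smul_inv_smul₀ hR.ne', hw']; simp
      have h1 : ‖R⁻¹ • w‖ < 1 := by
        have h2 := norm_sq_add_smul_isometry hpJ R (R⁻¹ • w)
        rw [← hxw] at h2
        have h3 : ‖x‖ < 1 := by simpa using hx1
        by_contra hc
        have h4 : 1 ≤ ‖R⁻¹ • w‖ ^ 2 := one_le_pow₀ (not_lt.1 hc)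
        have h5 : R ^ 2 * 1 ≤ R ^ 2 * ‖R⁻¹ • w‖ ^ 2 := mul_le_mul_of_nonneg_left h4 (by positivity)
        nlinarith [norm_nonneg x]
      have h2 := norm_discAut_lt_one ha' hb' h1
      refine ⟨h (discAut (-a) (-b) (R⁻¹ • w)), ?_⟩
      have h3 := discAut_neg_discAut ha' hb' h1
      rw [neg_neg, neg_neg] at h3
      rw [hf _ (by simpa using h2), h3, ← hxw]
  have hG : ∀ z, ‖z‖ < 1 → ContDiffAt ℝ ∞ (fun w => p + R • J (discAut b a w)) z := by
    intro z hz
    have h1 : ContDiffAt ℝ ∞ (discAut b a) z :=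
      (analyticAt_discAut hb ha hz).contDiffAt.restrict_scalars ℝ
    exact contDiffAt_const.add ((J.contDiff.contDiffAt.comp z h1).const_smul R)
  have hGc : ∀ w, ConformalAt (fun w => p + R • J w) w := fun w =>
    ⟨R • J.toContinuousLinearMap, ((J.toContinuousLinearMap.hasFDerivAt).const_smul R).const_add p,
      R, hR.ne', J, rfl⟩
  refine ⟨fun q => ?_, hrange, ⟨h ∘ ν, ?_, fun q => ?_⟩, fun e he v hv => ?_⟩
  · exact ((ContDiffAt.contMDiffAt (hG _ (hφ1 q))).comp q (hφd.contMDiff q)).congr_of_eventuallyEq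
      (Eventually.of_forall hfφ)
  · rw [← hrange]
    rintro _ ⟨q, rfl⟩
    have h1 : ν (f q) = φ q := by rw [hfφ, hνz _ (hφ1 q)]
    have h2 : ‖P (f q)‖ < 1 := by rw [hfφ, hPw]; exact norm_discAut_lt_one hb ha (hφ1 q)
    have h3 : ContDiffAt ℝ ∞ ν (f q) :=
      ((analyticAt_discAut ha' hb' h2).contDiffAt.restrict_scalars ℝ).comp (f q) hPs.contDiffAt
    have h4 : ContMDiffAt 𝓘(ℝ, ℂ) 𝓘(ℝ, ℂ) ∞ h (ν (f q)) := by
      rw [h1]; exact hh.contMDiffAt (hφ1 q)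
    exact (h4.comp (f q) h3.contMDiffAt).contMDiffWithinAt
  · rw [Function.comp_apply, hfφ, hνz _ (hφ1 q), hφ]
  · have h1 : f ∘ e.symm = (fun w => p + R • J w) ∘ (discAut b a) ∘ (φ ∘ e.symm) := by
      ext1 w; simp [hfφ]
    rw [h1]
    exact (hGc _).comp v ((conformalAt_discAut hb ha (hφ1 _)).comp v (hφd.conformalAt e he v hv))

end Surface

end

theorem theorem2p6 {M : Type*} [TopologicalSpace M] [T2Space M] [ConnectedSpace M]
    [ChartedSpace ℂ M] [IsManifold 𝓘(ℝ, ℂ) ∞ M] [HasGroupoid M (conformalGroupoid (X := ℂ))]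
    (hM : IsHyperbolicSurface M) (n : ℕ) (hn : 3 ≤ n)
    (f : M → EuclideanSpace ℝ (Fin n)) (hball : ∀ p, f p ∈ ball (0 : EuclideanSpace ℝ (Fin n)) 1)
    (hharm : IsHarmonicMap f) (hconf : IsConformalMapOnSurface f) :
    (∀ (p : M) (ξ : TangentSpace 𝓘(ℝ, ℂ) p),
      cayleyKlein (f p) (mfderiv 𝓘(ℝ, ℂ) 𝓘(ℝ, EuclideanSpace ℝ (Fin n)) f p ξ)
        ≤ poincareMetric p ξ) ∧
    (∀ p q : M, cayleyKleinEDist (f p) (f q) ≤ poincareEDist p q) ∧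
    (((∃ (p : M) (ξ : TangentSpace 𝓘(ℝ, ℂ) p), ξ ≠ 0 ∧
        cayleyKlein (f p) (mfderiv 𝓘(ℝ, ℂ) 𝓘(ℝ, EuclideanSpace ℝ (Fin n)) f p ξ)
          = poincareMetric p ξ) ∨
      (∃ p q : M, p ≠ q ∧ cayleyKleinEDist (f p) (f q) = poincareEDist p q)) →
      (∃ φ : M → ℂ, IsConformalDiffeoOnto φ (ball 0 1)) ∧
      ∃ S : Set (EuclideanSpace ℝ (Fin n)), IsAffineDisc S ∧ IsConformalDiffeoOnto f S) := by
  obtain ⟨h, hh⟩ := hM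
  refine ⟨cayleyKlein_mfderiv_le hh hharm hball hconf,
    cayleyKleinEDist_le_poincareEDist hh hharm hball hconf, fun heq => ?_⟩
  have key : ∃ z ∈ ball (0 : ℂ) 1, ∃ η : ℂ, η ≠ 0 ∧
      kleinNorm ((f ∘ h) z) (fderiv ℝ (f ∘ h) z η) = discPoincareMetric z η := by
    rcases heq with ⟨p, ξ, hξ, heq⟩ | ⟨p, q, hpq, heq⟩
    · obtain ⟨z, η, hz, hp, hη⟩ := hh.exists_tangent p ξ
      obtain ⟨h1, h2⟩ := hh.metrics_eq hharm hz hp ξ η hη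
      refine ⟨z, by simpa using hz, η, ?_, by rw [← h1, ← h2, heq]⟩
      rintro rfl
      exact hξ (hη.symm.trans (map_zero _))
    · exact exists_metric_eq_of_edist_eq hh hharm hball hconf hpq heq
  obtain ⟨z, hz, η, hη, heq⟩ := key
  have hz' : ‖z‖ < 1 := by simpa using hz
  obtain ⟨p, R, J, b, hpJ, hR, hpR, hb, hF⟩ := eq_affineDisc_of_kleinNorm_fderiv_eq
    (hh.harmonicOnNhd_comp hharm) (fun z _ => by simpa using hball (h z)) hz'
    (hh.isWeaklyConformal_comp hconf hz') hη heq
  exact hh.conformalDiffeos_of_lift_eq hpJ hR hpR hb (a := -z) (by rwa [norm_neg]) hF
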